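/- Let $(M,g)$ be a compact smooth ($C^\infty$) Riemannian manifold without boundary. For a smooth function $f\colon M\to\mathbb R$ let $\nabla f$ be its gradient (the vector field with $g(\nabla f,\cdot)=df$) and let $\nabla^2 f$ be its Hessian, regarded as the endomorphism $X\mapsto \nabla_X(\nabla f)$ of $TM$, where $\nabla$ is the Levi-Civita connection of $g$. For an endomorphism $A$ of a tangent space put $|A|^2=\operatorname{tr}(A^{\dagger}A)$, where $A^{\dagger}$ is the adjoint of $A$ with respect to $g$, and let $d\mathrm{Vol}_g$ be the Riemannian volume measure. Then there is a constant $C>0$ (depending only on $(M,g)$) such that every smooth function $u\colon M\to(0,\infty)$ satisfies $$\int_M |\nabla^2\sqrt u|^2\,d\mathrm{Vol}_g\;\le\; C\int_M u\,|\nabla^2\log u|^2\,d\mathrm{Vol}_g .$$ -/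

import Mathlib

open Bundle Manifold MeasureTheory
open scoped ContDiff

set_option linter.unusedSectionVars false

noncomputable section

namespace RiemHess

section Connection

variable {E : Type*} [NormedAddCommGroup E] [NormedSpace ℝ E] [FiniteDimensional ℝ E]
  {H : Type*} [TopologicalSpace H] {I : ModelWithCorners ℝ E H}
  {M : Type*} [TopologicalSpace M] [ChartedSpace H M] [IsManifold I ∞ M]
  [RiemannianBundle (fun x : M => TangentSpace I x)]
  [IsContMDiffRiemannianBundle I ∞ E (fun x : M => TangentSpace I x)]

/-- Tangent spaces of a finite-dimensional manifold are finite-dimensional. -/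
instance finiteDimensional_tangentSpace (x : M) : FiniteDimensional ℝ (TangentSpace I x) :=
  inferInstanceAs (FiniteDimensional ℝ E)

/-- Finite-dimensional tangent spaces are complete for the Riemannian norm. -/
instance completeSpace_tangentSpace (x : M) : CompleteSpace (TangentSpace I x) :=
  FiniteDimensional.complete ℝ (TangentSpace I x)

variable (I) in
/-- The right-hand side of the Koszul formula: for differentiable vector fields,
`koszul I X Y Z x = ⟨∇_X Y, Z⟩` at `x`, where `∇` is the Levi-Civita connection. -/
def koszul (X Y Z : Π x : M, TangentSpace I x) (x : M) : ℝ :=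
  (mvfderiv I (fun y => inner ℝ (Y y) (Z y)) x (X x)
    + mvfderiv I (fun y => inner ℝ (X y) (Z y)) x (Y x)
    - mvfderiv I (fun y => inner ℝ (X y) (Y y)) x (Z x)
    + inner ℝ (VectorField.mlieBracket I X Y x) (Z x)
    - inner ℝ (VectorField.mlieBracket I X Z x) (Y x)
    - inner ℝ (VectorField.mlieBracket I Y Z x) (X x)) / 2

theorem mdifferentiableAt_inner {x : M} {X Y : Π x : M, TangentSpace I x}
    (hX : MDiffAt (T% X) x) (hY : MDiffAt (T% Y) x) :
    MDiffAt (fun y => (inner ℝ (X y) (Y y) : ℝ)) x :=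
  MDifferentiableAt.inner_bundle (IB := I) (F := E) (E := fun x : M => TangentSpace I x) hX hY

theorem mvfderiv_inner_smul {x : M} {f : M → ℝ} {X Y : Π x : M, TangentSpace I x}
    (hf : MDiffAt f x) (hX : MDiffAt (T% X) x) (hY : MDiffAt (T% Y) x) (v : TangentSpace I x) :
    mvfderiv I (fun y => inner ℝ ((f • X) y) (Y y)) x v =
      f x * mvfderiv I (fun y => inner ℝ (X y) (Y y)) x v
        + inner ℝ (X x) (Y x) * mvfderiv I f x v := by
  have h : (fun y => (inner ℝ ((f • X) y) (Y y) : ℝ)) =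
      f * fun y => (inner ℝ (X y) (Y y) : ℝ) := by
    ext y
    simp [inner_smul_left]
  rw [h, mvfderiv_mul hf (mdifferentiableAt_inner hX hY)]
  simp

theorem mvfderiv_inner_add {x : M} {X X' Y : Π x : M, TangentSpace I x}
    (hX : MDiffAt (T% X) x) (hX' : MDiffAt (T% X') x) (hY : MDiffAt (T% Y) x)
    (v : TangentSpace I x) :
    mvfderiv I (fun y => inner ℝ ((X + X') y) (Y y)) x v =
      mvfderiv I (fun y => inner ℝ (X y) (Y y)) x v
        + mvfderiv I (fun y => inner ℝ (X' y) (Y y)) x v := by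
  have h : (fun y => (inner ℝ ((X + X') y) (Y y) : ℝ)) =
      (fun y => (inner ℝ (X y) (Y y) : ℝ)) + fun y => (inner ℝ (X' y) (Y y) : ℝ) := by
    ext y
    simp [inner_add_left]
  rw [h, mvfderiv_add (mdifferentiableAt_inner hX hY) (mdifferentiableAt_inner hX' hY)]
  simp

theorem mvfderiv_inner_comm (x : M) (X Y : Π x : M, TangentSpace I x) :
    mvfderiv I (fun y => (inner ℝ (X y) (Y y) : ℝ)) x =
      mvfderiv I (fun y => (inner ℝ (Y y) (X y) : ℝ)) x := by
  congr 1
  ext y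
  exact real_inner_comm _ _

theorem koszul_tensorial_left {x : M} {Y : Π x : M, TangentSpace I x} (hY : MDiffAt (T% Y) x)
    (Z : Π x : M, TangentSpace I x) (hZ : MDiffAt (T% Z) x) :
    TensorialAt I E (fun X => koszul I X Y Z x) x where
  smul {f X} hf hX := by
    simp only [koszul, VectorField.mlieBracket_smul_left hf hX,
      mvfderiv_inner_smul hf hX hZ, mvfderiv_inner_smul hf hX hY]
    simp only [Pi.smul_apply', map_smul, inner_smul_left, inner_smul_right, inner_add_left, smul_eq_mul, RCLike.conj_to_real,
      neg_smul, inner_neg_left]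
    ring
  add {X X'} hX hX' := by
    simp only [koszul, VectorField.mlieBracket_add_left hX hX',
      mvfderiv_inner_add hX hX' hZ, mvfderiv_inner_add hX hX' hY]
    simp only [Pi.add_apply, map_add, inner_add_left, inner_add_right]
    ring

theorem koszul_tensorial_right {x : M} {Y : Π x : M, TangentSpace I x} (hY : MDiffAt (T% Y) x)
    (X : Π x : M, TangentSpace I x) (hX : MDiffAt (T% X) x) :
    TensorialAt I E (fun Z => koszul I X Y Z x) x where
  smul {f Z} hf hZ := by
    simp only [koszul, VectorField.mlieBracket_smul_right hf hZ, mvfderiv_inner_comm x Y (f • Z),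
      mvfderiv_inner_comm x X (f • Z), mvfderiv_inner_comm x Y Z, mvfderiv_inner_comm x X Z,
      mvfderiv_inner_smul hf hZ hX, mvfderiv_inner_smul hf hZ hY]
    simp only [Pi.smul_apply', map_smul, real_inner_comm (Z x), inner_smul_left, inner_smul_right, inner_add_left, smul_eq_mul, RCLike.conj_to_real]
    ring
  add {Z Z'} hZ hZ' := by
    simp only [koszul, VectorField.mlieBracket_add_right hZ hZ', mvfderiv_inner_comm x Y (Z + Z'),
      mvfderiv_inner_comm x X (Z + Z'), mvfderiv_inner_comm x Y Z, mvfderiv_inner_comm x X Z,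
      mvfderiv_inner_comm x Y Z', mvfderiv_inner_comm x X Z',
      mvfderiv_inner_add hZ hZ' hX, mvfderiv_inner_add hZ hZ' hY]
    simp only [Pi.add_apply, map_add, inner_add_left, inner_add_right]
    ring

open scoped Classical in
variable (I) in
/-- The Levi-Civita derivative of the vector field `Y`: at a point `x` where `Y` is differentiable,
`leviCivitaAux I Y x v` is the tangent vector `∇_v Y` determined by the Koszul formula
`⟨∇_X Y, Z⟩ = koszul I X Y Z`; at the other points it is `0` by convention. -/
def leviCivitaAux (Y : Π x : M, TangentSpace I x) (x : M) :
    TangentSpace I x →L[ℝ] TangentSpace I x :=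
  if hY : MDiffAt (T% Y) x then
    InnerProductSpace.continuousLinearMapOfBilin (𝕜 := ℝ)
      (TensorialAt.mkHom₂ (fun X Z => koszul I X Y Z x) x
        (koszul_tensorial_left hY) (koszul_tensorial_right hY))
  else 0

theorem inner_leviCivitaAux {x : M} {X Y Z : Π x : M, TangentSpace I x}
    (hX : MDiffAt (T% X) x) (hY : MDiffAt (T% Y) x) (hZ : MDiffAt (T% Z) x) :
    inner ℝ (leviCivitaAux I Y x (X x)) (Z x) = koszul I X Y Z x := by
  rw [leviCivitaAux, dif_pos hY, InnerProductSpace.continuousLinearMapOfBilin_apply]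
  exact TensorialAt.mkHom₂_apply (koszul_tensorial_left hY) (koszul_tensorial_right hY) hX hZ

/-- Two endomorphisms of a tangent space agree if their pairings agree on the values of
differentiable vector fields. -/
theorem endomorphism_ext {x : M} {A B : TangentSpace I x →L[ℝ] TangentSpace I x}
    (h : ∀ X Z : Π x : M, TangentSpace I x, MDiffAt (T% X) x → MDiffAt (T% Z) x →
      (inner ℝ (A (X x)) (Z x) : ℝ) = inner ℝ (B (X x)) (Z x)) : A = B := by
  ext1 v
  refine ext_inner_right ℝ fun w => ?_
  have := h (FiberBundle.extend E v) (FiberBundle.extend E w)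
    (FiberBundle.mdifferentiableAt_extend ..) (FiberBundle.mdifferentiableAt_extend ..)
  simpa using this

variable (I M) in
/-- The Levi-Civita connection of a Riemannian manifold. -/
def leviCivita : CovariantDerivative I E (TangentSpace I : M → Type _) where
  toFun := leviCivitaAux I
  isCovariantDerivativeOnUniv :=
    { add := by
        intro Y Y' x hY hY' _
        refine endomorphism_ext fun X Z hX hZ => ?_
        rw [inner_leviCivitaAux hX (mdifferentiableAt_add_section hY hY') hZ]
        simp only [add_apply, inner_add_left, inner_leviCivitaAux hX hY hZ,
          inner_leviCivitaAux hX hY' hZ]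
        simp only [koszul, VectorField.mlieBracket_add_right hY hY',
          VectorField.mlieBracket_add_left hY hY', mvfderiv_inner_comm x X (Y + Y'),
          mvfderiv_inner_comm x X Y, mvfderiv_inner_comm x X Y',
          mvfderiv_inner_add hY hY' hX, mvfderiv_inner_add hY hY' hZ]
        simp only [Pi.add_apply, map_add, inner_add_left, inner_add_right]
        ring
      leibniz := by
        intro Y f x hY hf _
        refine endomorphism_ext fun X Z hX hZ => ?_
        rw [inner_leviCivitaAux hX (hf.smul_section hY) hZ]
        simp only [add_apply, smul_apply,
          ContinuousLinearMap.smulRight_apply, inner_add_left, inner_smul_left,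
          inner_leviCivitaAux hX hY hZ]
        simp only [koszul, VectorField.mlieBracket_smul_right hf hY,
          VectorField.mlieBracket_smul_left hf hY, mvfderiv_inner_comm x X (f • Y),
          mvfderiv_inner_comm x X Y,
          mvfderiv_inner_smul hf hY hX, mvfderiv_inner_smul hf hY hZ]
        simp only [Pi.smul_apply', map_smul, inner_smul_left, inner_smul_right, inner_add_left,
          smul_eq_mul, RCLike.conj_to_real, neg_smul, inner_neg_left]
        ring }

/-- The Levi-Civita connection is torsion-free. -/
theorem leviCivita_torsion : (leviCivita I M).torsion = 0 := by
  rw [CovariantDerivative.torsion_eq_zero_iff]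
  intro X Y x hX hY
  refine ext_inner_right ℝ fun w => ?_
  have hZ := FiberBundle.mdifferentiableAt_extend (I := I) (F := E) (V := TangentSpace I) w
  have h1 := inner_leviCivitaAux hX hY hZ
  have h2 := inner_leviCivitaAux hY hX hZ
  rw [FiberBundle.extend_apply_self] at h1 h2
  rw [inner_sub_left]
  refine (congrArg₂ (· - ·) h1 h2).trans ?_
  simp only [koszul, mvfderiv_inner_comm x Y X, VectorField.mlieBracket_swap_apply (V := Y) (W := X),
    inner_neg_left, FiberBundle.extend_apply_self]
  ring

/-- The Levi-Civita connection is compatible with the metric. -/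
theorem leviCivita_metric {x : M} {X Y Z : Π x : M, TangentSpace I x}
    (hX : MDiffAt (T% X) x) (hY : MDiffAt (T% Y) x) (hZ : MDiffAt (T% Z) x) :
    mvfderiv I (fun y => (inner ℝ (Y y) (Z y) : ℝ)) x (X x) =
      inner ℝ (leviCivita I M Y x (X x)) (Z x) + inner ℝ (Y x) (leviCivita I M Z x (X x)) := by
  have h1 := inner_leviCivitaAux hX hY hZ
  have h2 := inner_leviCivitaAux hX hZ hY
  rw [real_inner_comm] at h2
  refine Eq.trans ?_ (congrArg₂ (· + ·) h1 h2).symm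
  simp only [koszul, mvfderiv_inner_comm x Z Y,
    VectorField.mlieBracket_swap_apply (V := Z) (W := Y), inner_neg_left]
  ring

variable (I) in
/-- The gradient of a function: `⟨grad f, v⟩ = df(v)`. -/
def grad (f : M → ℝ) (x : M) : TangentSpace I x :=
  (InnerProductSpace.toDual ℝ (TangentSpace I x)).symm (mvfderiv I f x)

variable (I) in
/-- The Hessian of a function, as the endomorphism `v ↦ ∇_v (grad f)` of the tangent space. -/
def hessian (f : M → ℝ) (x : M) : TangentSpace I x →L[ℝ] TangentSpace I x :=
  leviCivita I M (grad I f) x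

/-- The squared norm `|A|² = tr (A† A)` of an endomorphism of a tangent space, with `A†` the adjoint
for the Riemannian inner product. -/
def endNormSq {x : M} (A : TangentSpace I x →L[ℝ] TangentSpace I x) : ℝ :=
  LinearMap.trace ℝ (TangentSpace I x) ((ContinuousLinearMap.adjoint A ∘L A : _ →L[ℝ] _) : _ →ₗ[ℝ] _)

end Connection

section Volume

variable {n : ℕ} {M : Type*} [TopologicalSpace M] [ChartedSpace (EuclideanSpace ℝ (Fin n)) M]
  [RiemannianBundle (fun x : M => TangentSpace (𝓡 n) x)]

/-- The `i`-th coordinate vector field `∂ᵢ` of the preferred chart at `c`, at the point with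
coordinates `z`. -/
def coordVector (c : M) (z : EuclideanSpace ℝ (Fin n)) (i : Fin n) :
    TangentSpace (𝓡 n) ((extChartAt (𝓡 n) c).symm z) :=
  mfderiv 𝓘(ℝ, EuclideanSpace ℝ (Fin n)) (𝓡 n) (extChartAt (𝓡 n) c).symm z
    (EuclideanSpace.single i (1 : ℝ))

/-- The Gram matrix `gᵢⱼ = ⟨∂ᵢ, ∂ⱼ⟩` of the metric in the chart at `c`, as a function of the
coordinates. -/
def gramMatrix (c : M) (z : EuclideanSpace ℝ (Fin n)) : Matrix (Fin n) (Fin n) ℝ :=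
  Matrix.of fun i j => inner ℝ (coordVector c z i) (coordVector c z j)

/-- The Riemannian volume of the domain of the chart at `c`, as a measure on `M` which vanishes
outside this domain: the image under the inverse chart of `√(det gᵢⱼ) dz`. -/
def chartVolume [MeasurableSpace M] (c : M) : Measure M :=
  ((volume.restrict (extChartAt (𝓡 n) c).target).withDensity
    fun z => ENNReal.ofReal √(gramMatrix c z).det).map (extChartAt (𝓡 n) c).symm

variable (n M) in
/-- The Riemannian volume measure. By the change of variables formula the measures `chartVolume c`
and `chartVolume c'` agree on the overlap of the two chart domains, so that their least upper bound
in the lattice of measures is the measure that restricts to `√(det gᵢⱼ) dz` in each chart. -/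
def riemannianVolume [MeasurableSpace M] : Measure M := ⨆ c : M, chartVolume (n := n) c

end Volume

end RiemHess

end

/-! Put `φ = log u`. Since `∇√u = (√u/2) ∇φ`, the Leibniz rule gives `∇²√u = (√u/2) ∇²φ + (√u/4) ∇φ
⊗ ∇φ` (`hessian_sqrt`), hence `|∇²√u|² ≤ (u/2) |∇²φ|² + (u/8) |∇φ|⁴`. It remains to control `∫ u
|∇φ|⁴` by `∫ u |∇²φ|²`.

For this, take the divergence of `u |∇φ|² ∇φ`. Because `∇u = u ∇φ`, it equals `u (|∇φ|² Δφ + 2 ⟨∇²φ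
∇φ, ∇φ⟩ + |∇φ|⁴)` (`divergence_logGradField`). The quartic term appears with a positive sign, and
Young's inequality absorbs the other two into it at the cost of a multiple of `u |∇²φ|²`
(`young_trace_quadratic`). This gives the pointwise bound `|∇²√u|² ≤ (n+6)/4 · u |∇²φ|² + 1/4 · div
(u |∇φ|² ∇φ)` (`endNormSq_hessian_sqrt_le`), and the divergence integrates to zero.

Most of the work is the divergence theorem for the measure `riemannianVolume`
(`integral_divergence_eq_zero`). Jacobi's formula and the Koszul formula give the coordinate
expression `√det g · div Y = ∑ ∂ₖ (√det g · Yᵏ)` (`density_mul_divergence`); the change of variables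
formula identifies the volume on a chart domain with `√det g dz`
(`riemannianVolume_restrict_source`); a partition of unity reduces to fields supported in one chart,
where the integral of a partial derivative of a compactly supported function vanishes. -/

noncomputable section

namespace RiemHess

/-! ### Traces, Gram matrices and Hilbert–Schmidt norms. -/

section LinearAlgebra

variable {ι : Type*} [Fintype ι] [DecidableEq ι]
  {V : Type*} [NormedAddCommGroup V] [InnerProductSpace ℝ V]

theorem isUnit_det_gram (b : Module.Basis ι ℝ V) : IsUnit (Matrix.gram ℝ b).det :=
  isUnit_iff_ne_zero.2 (Matrix.det_gram_ne_zero_iff_linearIndependent.2 b.linearIndependent)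

/-- The coordinates of a vector, from the inverse Gram matrix. -/
theorem repr_eq_sum_gram_inv (b : Module.Basis ι ℝ V) (v : V) (i : ι) :
    b.repr v i = ∑ j, (Matrix.gram ℝ b)⁻¹ i j * inner ℝ v (b j) := by
  have h : (fun j => (inner ℝ v (b j) : ℝ)) = (Matrix.gram ℝ b).mulVec (fun i => b.repr v i) := by
    ext j
    conv_lhs => rw [← b.sum_repr v, sum_inner]
    simp only [Matrix.mulVec, dotProduct, Matrix.gram_apply, inner_smul_left, RCLike.conj_to_real]
    exact Finset.sum_congr rfl fun k _ => by rw [real_inner_comm, mul_comm]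
  have h2 := congrArg (fun w => (Matrix.gram ℝ b)⁻¹.mulVec w i) h
  simp only [Matrix.mulVec_mulVec, Matrix.nonsing_inv_mul _ (isUnit_det_gram b),
    Matrix.one_mulVec] at h2
  rw [← h2]
  rfl

/-- Only inner products against an arbitrary basis occur, so traces can be computed in a coordinate
frame, where all these entries are smooth. -/
theorem trace_eq_sum_gram_inv (b : Module.Basis ι ℝ V) (A : V →ₗ[ℝ] V) :
    LinearMap.trace ℝ V A = ∑ i, ∑ j, (Matrix.gram ℝ b)⁻¹ i j * inner ℝ (A (b i)) (b j) := by
  rw [LinearMap.trace_eq_matrix_trace ℝ b, Matrix.trace]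
  refine Finset.sum_congr rfl fun i _ => ?_
  rw [Matrix.diag_apply, LinearMap.toMatrix_apply, repr_eq_sum_gram_inv]

theorem inner_eq_sum_gram_inv (b : Module.Basis ι ℝ V) (v w : V) :
    inner ℝ v w = ∑ i, ∑ j, (Matrix.gram ℝ b)⁻¹ i j * inner ℝ v (b j) * inner ℝ w (b i) := by
  conv_lhs => rw [← b.sum_repr v, sum_inner]
  refine Finset.sum_congr rfl fun i _ => ?_
  rw [inner_smul_left, RCLike.conj_to_real, repr_eq_sum_gram_inv, Finset.sum_mul, real_inner_comm]

variable [FiniteDimensional ℝ V] [CompleteSpace V]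

theorem trace_adjoint_comp_eq_sum (b : Module.Basis ι ℝ V) (A : V →L[ℝ] V) :
    LinearMap.trace ℝ V ((ContinuousLinearMap.adjoint A ∘L A : V →L[ℝ] V) : V →ₗ[ℝ] V) =
      ∑ i, ∑ j, (Matrix.gram ℝ b)⁻¹ i j * inner ℝ (A (b i)) (A (b j)) := by
  rw [trace_eq_sum_gram_inv b]
  simp [ContinuousLinearMap.adjoint_inner_left]

theorem trace_adjoint_comp_eq_sum_norm_sq (b : OrthonormalBasis ι ℝ V) (A : V →L[ℝ] V) :
    LinearMap.trace ℝ V ((ContinuousLinearMap.adjoint A ∘L A : V →L[ℝ] V) : V →ₗ[ℝ] V) =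
      ∑ i, ‖A (b i)‖ ^ 2 := by
  rw [LinearMap.trace_eq_sum_inner _ b]
  simp [ContinuousLinearMap.adjoint_inner_right]

/-- Cauchy–Schwarz for the diagonal entries in an orthonormal basis, each of which is at most the
norm of its column. -/
theorem trace_sq_le (A : V →L[ℝ] V) :
    (LinearMap.trace ℝ V (A : V →ₗ[ℝ] V)) ^ 2 ≤ Module.finrank ℝ V *
      LinearMap.trace ℝ V ((ContinuousLinearMap.adjoint A ∘L A : V →L[ℝ] V) : V →ₗ[ℝ] V) := by
  have b := stdOrthonormalBasis ℝ V
  rw [trace_adjoint_comp_eq_sum_norm_sq b, LinearMap.trace_eq_sum_inner _ b]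
  have h := sq_sum_le_card_mul_sum_sq (s := Finset.univ)
    (f := fun i => (inner ℝ (b i) ((A : V →ₗ[ℝ] V) (b i)) : ℝ))
  rw [Finset.card_univ, Fintype.card_fin] at h
  refine h.trans (mul_le_mul_of_nonneg_left (Finset.sum_le_sum fun i _ => ?_) (Nat.cast_nonneg _))
  refine sq_le_sq' ?_ ?_
  · have := neg_le_of_abs_le (abs_real_inner_le_norm (b i) (A (b i)))
    simpa using this
  · have := real_inner_le_norm (b i) (A (b i))
    simpa using this

/-- The operator norm is at most the Hilbert–Schmidt norm: expand `v` in an orthonormal basis and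
apply Cauchy–Schwarz. -/
theorem norm_apply_sq_le (A : V →L[ℝ] V) (v : V) :
    ‖A v‖ ^ 2 ≤ LinearMap.trace ℝ V
      ((ContinuousLinearMap.adjoint A ∘L A : V →L[ℝ] V) : V →ₗ[ℝ] V) * ‖v‖ ^ 2 := by
  have b := stdOrthonormalBasis ℝ V
  rw [trace_adjoint_comp_eq_sum_norm_sq b, ← b.sum_sq_norm_inner_right v]
  have h : ‖A v‖ ≤ ∑ i, ‖A (b i)‖ * ‖(inner ℝ (b i) v : ℝ)‖ := by
    conv_lhs => rw [← b.sum_repr' v, map_sum]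
    refine (norm_sum_le _ _).trans (Finset.sum_le_sum fun i _ => ?_)
    rw [map_smul, norm_smul, mul_comm]
  exact (pow_le_pow_left₀ (norm_nonneg _) h 2).trans (Finset.sum_mul_sq_le_sq_mul_sq _ _ _)

theorem trace_adjoint_comp_nonneg (A : V →L[ℝ] V) :
    0 ≤ LinearMap.trace ℝ V
      ((ContinuousLinearMap.adjoint A ∘L A : V →L[ℝ] V) : V →ₗ[ℝ] V) := by
  rw [trace_adjoint_comp_eq_sum_norm_sq (stdOrthonormalBasis ℝ V)]
  positivity

/-- The Hilbert–Schmidt bound for a multiple of an endomorphism plus a rank one term. -/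
theorem trace_adjoint_comp_smul_add_le (A : V →L[ℝ] V) (a c : ℝ) (v : V) :
    LinearMap.trace ℝ V ((ContinuousLinearMap.adjoint (a • A + c • (innerSL ℝ v).smulRight v) ∘L
        (a • A + c • (innerSL ℝ v).smulRight v) : V →L[ℝ] V) : V →ₗ[ℝ] V) ≤
      2 * a ^ 2 * LinearMap.trace ℝ V
        ((ContinuousLinearMap.adjoint A ∘L A : V →L[ℝ] V) : V →ₗ[ℝ] V)
      + 2 * c ^ 2 * ‖v‖ ^ 4 := by
  have b := stdOrthonormalBasis ℝ V
  rw [trace_adjoint_comp_eq_sum_norm_sq b, trace_adjoint_comp_eq_sum_norm_sq b]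
  have h4 : ‖v‖ ^ 4 = ∑ i, (inner ℝ v (b i)) ^ 2 * ‖v‖ ^ 2 := by
    rw [← Finset.sum_mul]
    have := b.sum_sq_norm_inner_left v
    simp only [Real.norm_eq_abs, sq_abs] at this
    rw [this]; ring
  rw [h4, Finset.mul_sum, Finset.mul_sum, ← Finset.sum_add_distrib]
  refine Finset.sum_le_sum fun i _ => ?_
  have h : ‖(a • A + c • (innerSL ℝ v).smulRight v) (b i)‖ ≤
      |a| * ‖A (b i)‖ + |c| * (|inner ℝ v (b i)| * ‖v‖) := by
    refine (norm_add_le _ _).trans (le_of_eq ?_)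
    simp [norm_smul]
  refine (pow_le_pow_left₀ (norm_nonneg _) h 2).trans ?_
  refine add_sq_le.trans (le_of_eq ?_)
  rw [mul_pow, mul_pow, mul_pow, sq_abs, sq_abs, sq_abs]
  ring

end LinearAlgebra

/-! ### Derivative of a determinant. -/

section Jacobi

variable {ι : Type*} [Fintype ι] [DecidableEq ι]

/-- The value of the derivative involves the curve only through `A t` and `A'`, so any other curve
with the same first-order data may replace it. -/
theorem hasDerivAt_det_sum {A : ℝ → Matrix ι ι ℝ} {A' : Matrix ι ι ℝ} {t : ℝ}
    (hA : ∀ i j, HasDerivAt (fun s => A s i j) (A' i j) t) :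
    HasDerivAt (fun s => (A s).det) (∑ σ : Equiv.Perm ι, (Equiv.Perm.sign σ : ℝ) *
      ∑ i, (∏ j ∈ Finset.univ.erase i, A t (σ j) j) • A' (σ i) i) t := by
  simp only [Matrix.det_apply']
  refine HasDerivAt.fun_sum fun σ _ => HasDerivAt.const_mul _ ?_
  exact HasDerivAt.fun_finsetProd fun i _ => hA (σ i) i

/-- Jacobi's formula for the derivative of the determinant. -/
theorem hasDerivAt_det {A : ℝ → Matrix ι ι ℝ} {A' : Matrix ι ι ℝ} {t : ℝ}
    (hA : ∀ i j, HasDerivAt (fun s => A s i j) (A' i j) t) (h : IsUnit (A t).det) :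
    HasDerivAt (fun s => (A s).det) ((A t).det * ((A t)⁻¹ * A').trace) t := by
  have h1 := hasDerivAt_det_sum hA
  -- The affine curve has the same value and velocity, hence the same sum over permutations; its
  -- derivative is then computed in closed form and uniqueness of derivatives concludes.
  have h2 : HasDerivAt (fun s : ℝ => (A t + s • A').det) (∑ σ : Equiv.Perm ι,
      (Equiv.Perm.sign σ : ℝ) *
        ∑ i, (∏ j ∈ Finset.univ.erase i, A t (σ j) j) • A' (σ i) i) 0 := by
    have := hasDerivAt_det_sum (A := fun s : ℝ => A t + s • A') (A' := A') (t := 0) fun i j => by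
      simpa using ((hasDerivAt_id (0 : ℝ)).mul_const (A' i j)).const_add (A t i j)
    simpa using this
  have h3 : HasDerivAt (fun s : ℝ => (A t + s • A').det) ((A t).det * ((A t)⁻¹ * A').trace) 0 := by
    -- Factor out `A t` and expand `det (1 + s B) = 1 + s tr B + s² q(s)` with `q` a polynomial.
    have e : (fun s : ℝ => (A t + s • A').det) = fun s => (A t).det *
        (1 + ((A t)⁻¹ * A').trace * s + (Matrix.det (1 + (Polynomial.X : Polynomial ℝ) •
          ((A t)⁻¹ * A').map Polynomial.C)).divX.divX.eval s * s ^ 2) := by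
      ext s
      rw [← Matrix.det_one_add_smul, ← Matrix.det_mul, mul_add, mul_one, Matrix.mul_smul,
        Matrix.mul_nonsing_inv_cancel_left _ _ h]
    rw [e]
    generalize (Matrix.det (1 + (Polynomial.X : Polynomial ℝ) •
          ((A t)⁻¹ * A').map Polynomial.C)).divX.divX = q
    refine HasDerivAt.const_mul _ ?_
    refine (HasDerivAt.fun_add
      (((hasDerivAt_id' (0 : ℝ)).const_mul ((A t)⁻¹ * A').trace).const_add 1)
      (HasDerivAt.fun_mul (q.hasDerivAt 0) (hasDerivAt_pow 2 (0 : ℝ)))).congr_deriv ?_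
    simp
  rwa [h2.unique h3] at h1

end Jacobi

/-! ### Coordinate frames and differentiation in a chart. -/

section Frame

variable {n : ℕ} {M : Type*} [TopologicalSpace M] [ChartedSpace (EuclideanSpace ℝ (Fin n)) M]
  [IsManifold (𝓡 n) ∞ M]

/-- Smoothness of a vector field at a point. -/
abbrev SmoothFieldAt (Y : Π x : M, TangentSpace (𝓡 n) x) (x : M) : Prop :=
  ContMDiffAt (𝓡 n) ((𝓡 n).prod 𝓘(ℝ, EuclideanSpace ℝ (Fin n))) ∞ (T% Y) x

/-- Differentiability of a vector field at a point. -/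
abbrev DiffFieldAt (Y : Π x : M, TangentSpace (𝓡 n) x) (x : M) : Prop :=
  MDifferentiableAt (𝓡 n) ((𝓡 n).prod 𝓘(ℝ, EuclideanSpace ℝ (Fin n))) (T% Y) x

variable (n) in
/-- Smoothness of a real function at a point. -/
abbrev SmoothFunAt (f : M → ℝ) (x : M) : Prop := ContMDiffAt (𝓡 n) 𝓘(ℝ, ℝ) ∞ f x

variable (n) in
/-- Differentiability of a real function at a point. -/
abbrev DiffFunAt (f : M → ℝ) (x : M) : Prop := MDifferentiableAt (𝓡 n) 𝓘(ℝ, ℝ) f x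

theorem SmoothFieldAt.diff {Y : Π x : M, TangentSpace (𝓡 n) x} {x : M} (h : SmoothFieldAt Y x) :
    DiffFieldAt Y x :=
  ContMDiffAt.mdifferentiableAt h (by simp)

theorem SmoothFunAt.diff {f : M → ℝ} {x : M} (h : SmoothFunAt n f x) : DiffFunAt n f x :=
  ContMDiffAt.mdifferentiableAt h (by simp)

theorem SmoothFunAt.eventually_diff {f : M → ℝ} {x : M} (h : SmoothFunAt n f x) :
    ∀ᶠ y in nhds x, DiffFunAt n f y := by
  have h1 : ContMDiffAt (𝓡 n) 𝓘(ℝ, ℝ) 1 f x := ContMDiffAt.of_le h (by simp)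
  filter_upwards [(contMDiffAt_iff_contMDiffAt_nhds (by simp)).1 h1] with y hy
  exact hy.mdifferentiableAt (by simp)

/-- The coordinate vector field `∂ᵢ` of the preferred chart at `c`, on the chart domain. -/
def frame (c : M) (i : Fin n) : Π x : M, TangentSpace (𝓡 n) x :=
  (trivializationAt (EuclideanSpace ℝ (Fin n)) (TangentSpace (𝓡 n)) c).localFrame
    (EuclideanSpace.basisFun (Fin n) ℝ).toBasis i

/-- The coordinates of a tangent vector in the coordinate frame of the chart at `c`. -/
def frameCoeff (c : M) (i : Fin n) (x : M) : TangentSpace (𝓡 n) x →ₗ[ℝ] ℝ :=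
  (trivializationAt (EuclideanSpace ℝ (Fin n)) (TangentSpace (𝓡 n)) c).localFrameCoeff (𝓡 n)
    (EuclideanSpace.basisFun (Fin n) ℝ).toBasis i x

theorem mem_baseSet {c x : M} : x ∈ (trivializationAt (EuclideanSpace ℝ (Fin n))
    (TangentSpace (𝓡 n)) c).baseSet ↔ x ∈ (extChartAt (𝓡 n) c).source := by
  rw [extChartAt_source, TangentBundle.trivializationAt_baseSet]

/-- The basis of the tangent space given by the coordinate frame. -/
def frameBasis (c : M) {x : M} (hx : x ∈ (extChartAt (𝓡 n) c).source) :
    Module.Basis (Fin n) ℝ (TangentSpace (𝓡 n) x) :=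
  (trivializationAt (EuclideanSpace ℝ (Fin n)) (TangentSpace (𝓡 n)) c).basisAt
    (EuclideanSpace.basisFun (Fin n) ℝ).toBasis (mem_baseSet.2 hx)

theorem frameBasis_apply {c x : M} (hx : x ∈ (extChartAt (𝓡 n) c).source) (i : Fin n) :
    frameBasis c hx i = frame c i x :=
  (Trivialization.localFrame_apply_of_mem_baseSet _ _ (mem_baseSet.2 hx)).symm

theorem frameCoeff_eq_repr {c x : M} (hx : x ∈ (extChartAt (𝓡 n) c).source) (i : Fin n)
    (v : TangentSpace (𝓡 n) x) : frameCoeff c i x v = (frameBasis c hx).repr v i := by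
  have := Trivialization.localFrameCoeff_apply_of_mem_baseSet (I := 𝓡 n)
    (trivializationAt (EuclideanSpace ℝ (Fin n)) (TangentSpace (𝓡 n)) c)
    (EuclideanSpace.basisFun (Fin n) ℝ).toBasis (mem_baseSet.2 hx)
    (FiberBundle.extend (EuclideanSpace ℝ (Fin n)) v) i
  rw [FiberBundle.extend_apply_self] at this
  exact this

theorem sum_frameCoeff_smul {c x : M} (hx : x ∈ (extChartAt (𝓡 n) c).source)
    (v : TangentSpace (𝓡 n) x) : ∑ i, frameCoeff c i x v • frame c i x = v := by
  simp only [frameCoeff_eq_repr hx, ← frameBasis_apply hx, Module.Basis.sum_repr]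

theorem contMDiffAt_frame {c x : M} (hx : x ∈ (extChartAt (𝓡 n) c).source) (i : Fin n) :
    SmoothFieldAt (frame c i) x :=
  contMDiffAt_localFrame_of_mem ∞ _ _ i (mem_baseSet.2 hx)

theorem mdifferentiableAt_frame {c x : M} (hx : x ∈ (extChartAt (𝓡 n) c).source) (i : Fin n) :
    DiffFieldAt (frame c i) x :=
  (contMDiffAt_frame hx i).diff

theorem contMDiffAt_iff_frameCoeff {c x : M} (hx : x ∈ (extChartAt (𝓡 n) c).source)
    {Y : Π x : M, TangentSpace (𝓡 n) x} :
    SmoothFieldAt Y x ↔ ∀ i, SmoothFunAt n (fun y => frameCoeff c i y (Y y)) x :=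
  contMDiffAt_iff_localFrameCoeff _ (mem_baseSet.2 hx)

/-- This links the bundle trivialization, which supplies smoothness and coefficients, to the
derivative of the inverse chart, which defines the volume. -/
theorem frame_eq_symmL {c x : M} (hx : x ∈ (extChartAt (𝓡 n) c).source) (i : Fin n) :
    frame c i x = mfderiv 𝓘(ℝ, EuclideanSpace ℝ (Fin n)) (𝓡 n) (extChartAt (𝓡 n) c).symm
      (extChartAt (𝓡 n) c x) (EuclideanSpace.single i (1 : ℝ)) := by
  have h := TangentBundle.symmL_trivializationAt (I := 𝓡 n) (𝕜 := ℝ)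
    (show x ∈ (chartAt (EuclideanSpace ℝ (Fin n)) c).source by rwa [extChartAt_source] at hx)
  rw [modelWithCornersSelf_coe, Set.range_id, mfderivWithin_univ] at h
  rw [← h, ← frameBasis_apply hx, frameBasis, Trivialization.basisAt]
  simp only [Module.Basis.map_apply, OrthonormalBasis.coe_toBasis, EuclideanSpace.basisFun_apply]
  exact (Trivialization.symmL_apply _ (mem_baseSet.2 hx) _).symm

theorem frame_symm {c : M} {z : EuclideanSpace ℝ (Fin n)} (hz : z ∈ (extChartAt (𝓡 n) c).target)
    (i : Fin n) : frame c i ((extChartAt (𝓡 n) c).symm z) = coordVector c z i := by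
  rw [frame_eq_symmL ((extChartAt (𝓡 n) c).map_target hz), (extChartAt (𝓡 n) c).right_inv hz]
  rfl

theorem mfderiv_extChartAt_frame {c x : M} (hx : x ∈ (extChartAt (𝓡 n) c).source) (i : Fin n) :
    mfderiv (𝓡 n) 𝓘(ℝ, EuclideanSpace ℝ (Fin n)) (extChartAt (𝓡 n) c) x (frame c i x) =
      EuclideanSpace.single i (1 : ℝ) := by
  have h := mfderiv_extChartAt_comp_mfderivWithin_extChartAt_symm (I := 𝓡 n)
    ((extChartAt (𝓡 n) c).map_source hx)
  rw [modelWithCornersSelf_coe, Set.range_id, mfderivWithin_univ] at h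
  rw [frame_eq_symmL hx]
  have h2 := DFunLike.congr_fun h (EuclideanSpace.single i (1 : ℝ))
  rw [(extChartAt (𝓡 n) c).left_inv hx] at h2
  exact h2

/-- The frame is the pullback under the chart of constant fields, which commute, and the bracket is
natural under pullback. -/
theorem mlieBracket_frame {c x : M} (hx : x ∈ (extChartAt (𝓡 n) c).source) (i j : Fin n) :
    VectorField.mlieBracket (𝓡 n) (frame c i) (frame c j) x = 0 := by
  let W : Fin n → Π z : EuclideanSpace ℝ (Fin n), TangentSpace 𝓘(ℝ, EuclideanSpace ℝ (Fin n)) z :=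
    fun i _ => EuclideanSpace.single i (1 : ℝ)
  have hW : ∀ i z, DiffFieldAt (W i) z := fun i z =>
    SmoothFieldAt.diff (contMDiffAt_vectorSpace_iff_contDiffAt.2 contDiffAt_const)
  have hpull : ∀ i, VectorField.mpullback (𝓡 n) 𝓘(ℝ, EuclideanSpace ℝ (Fin n))
      (extChartAt (𝓡 n) c) (W i) =ᶠ[nhds x] frame c i := fun i => by
    filter_upwards [(isOpen_extChartAt_source (I := 𝓡 n) c).mem_nhds hx] with y hy
    rw [VectorField.mpullback_apply]
    have h1 : W i (extChartAt (𝓡 n) c y) = mfderiv (𝓡 n) 𝓘(ℝ, EuclideanSpace ℝ (Fin n))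
      (extChartAt (𝓡 n) c) y (frame c i y) := (mfderiv_extChartAt_frame hy i).symm
    rw [h1]
    exact (isInvertible_mfderiv_extChartAt hy).inverse_apply_eq.2 rfl
  have : IsManifold (𝓡 n) (minSmoothness ℝ 2) M := by
    rw [minSmoothness_of_isRCLikeNormedField]
    exact IsManifold.of_le (n := ∞) ENat.LEInfty.out
  rw [← Filter.EventuallyEq.mlieBracket_vectorField_eq (hpull i) (hpull j),
    ← VectorField.mpullback_mlieBracket (n := ∞) (hW i _) (hW j _)
      (contMDiffAt_extChartAt' (by rwa [extChartAt_source] at hx)) 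
      (by rw [minSmoothness_of_isRCLikeNormedField]; exact ENat.LEInfty.out),
    VectorField.mpullback_apply]
  have h0 : VectorField.mlieBracket 𝓘(ℝ, EuclideanSpace ℝ (Fin n)) (W i) (W j)
      (extChartAt (𝓡 n) c x) = 0 := by
    rw [← VectorField.mlieBracketWithin_univ, VectorField.mlieBracketWithin_eq_lieBracketWithin,
      VectorField.lieBracketWithin_univ, VectorField.lieBracket_eq]
    simp
    rfl
  rw [h0, map_zero]

theorem mdifferentiableAt_extChartAt_symm' {c : M} {z : EuclideanSpace ℝ (Fin n)}
    (hz : z ∈ (extChartAt (𝓡 n) c).target) :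
    MDifferentiableAt 𝓘(ℝ, EuclideanSpace ℝ (Fin n)) (𝓡 n) (extChartAt (𝓡 n) c).symm z := by
  have := mdifferentiableWithinAt_extChartAt_symm (I := 𝓡 n) hz
  rwa [modelWithCornersSelf_coe, Set.range_id, mdifferentiableWithinAt_univ] at this

theorem mvfderiv_coordVector {c : M} {z : EuclideanSpace ℝ (Fin n)}
    (hz : z ∈ (extChartAt (𝓡 n) c).target) (i : Fin n) {f : M → ℝ}
    (hf : DiffFunAt n f ((extChartAt (𝓡 n) c).symm z)) :
    mvfderiv (𝓡 n) f ((extChartAt (𝓡 n) c).symm z) (coordVector c z i) =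
      fderiv ℝ (f ∘ (extChartAt (𝓡 n) c).symm) z (EuclideanSpace.single i 1) := by
  rw [← mfderiv_eq_fderiv, mfderiv_comp z hf (mdifferentiableAt_extChartAt_symm' hz)]
  rfl

/-- The derivative along a coordinate vector field is the partial derivative in the chart. -/
theorem mvfderiv_frame {c x : M} (hx : x ∈ (extChartAt (𝓡 n) c).source) (i : Fin n) {f : M → ℝ}
    (hf : DiffFunAt n f x) : mvfderiv (𝓡 n) f x (frame c i x) =
      fderiv ℝ (f ∘ (extChartAt (𝓡 n) c).symm) (extChartAt (𝓡 n) c x)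
        (EuclideanSpace.single i 1) := by
  obtain ⟨z, hz, rfl⟩ : ∃ z ∈ (extChartAt (𝓡 n) c).target, (extChartAt (𝓡 n) c).symm z = x :=
    ⟨_, (extChartAt (𝓡 n) c).map_source hx, (extChartAt (𝓡 n) c).left_inv hx⟩
  rw [frame_symm hz, mvfderiv_coordVector hz i hf, (extChartAt (𝓡 n) c).right_inv hz]

theorem contDiffAt_comp_symm {c : M} {z : EuclideanSpace ℝ (Fin n)}
    (hz : z ∈ (extChartAt (𝓡 n) c).target) {f : M → ℝ}
    (hf : SmoothFunAt n f ((extChartAt (𝓡 n) c).symm z)) :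
    ContDiffAt ℝ ∞ (f ∘ (extChartAt (𝓡 n) c).symm) z := by
  rw [← contMDiffAt_iff_contDiffAt]
  exact hf.comp z ((contMDiffOn_extChartAt_symm (I := 𝓡 n) (n := ∞) c).contMDiffAt
    ((isOpen_extChartAt_target c).mem_nhds hz))

theorem contMDiffAt_mvfderiv_frame {c x : M} (hx : x ∈ (extChartAt (𝓡 n) c).source) (i : Fin n)
    {f : M → ℝ} (hf : SmoothFunAt n f x) :
    SmoothFunAt n (fun y => mvfderiv (𝓡 n) f y (frame c i y)) x := by
  have h1 : SmoothFunAt n ((fun z => fderiv ℝ (f ∘ (extChartAt (𝓡 n) c).symm) z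
      (EuclideanSpace.single i 1)) ∘ extChartAt (𝓡 n) c) x := by
    refine ContMDiffAt.comp x (contMDiffAt_iff_contDiffAt.2 ?_)
      (contMDiffAt_extChartAt' (by rwa [extChartAt_source] at hx))
    refine ContDiffAt.clm_apply (ContDiffAt.fderiv_right (m := ∞) (n := ∞) ?_ (by simp))
      contDiffAt_const
    refine contDiffAt_comp_symm ((extChartAt (𝓡 n) c).map_source hx) ?_
    rwa [(extChartAt (𝓡 n) c).left_inv hx]
  refine h1.congr_of_eventuallyEq ?_
  filter_upwards [(isOpen_extChartAt_source (I := 𝓡 n) c).mem_nhds hx,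
    SmoothFunAt.eventually_diff hf] with y hy hf
  exact mvfderiv_frame hy i hf

end Frame

/-! ### Smoothness of the gradient, divergence and Hessian norm. -/

section MetricSmoothness

variable {n : ℕ} {M : Type*} [TopologicalSpace M] [ChartedSpace (EuclideanSpace ℝ (Fin n)) M]
  [IsManifold (𝓡 n) ∞ M]

theorem SmoothFunAt.add {f g : M → ℝ} {x : M} (hf : SmoothFunAt n f x) (hg : SmoothFunAt n g x) :
    SmoothFunAt n (fun y => f y + g y) x :=
  ContMDiffAt.add hf hg

theorem SmoothFunAt.sub {f g : M → ℝ} {x : M} (hf : SmoothFunAt n f x) (hg : SmoothFunAt n g x) :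
    SmoothFunAt n (fun y => f y - g y) x :=
  ContMDiffAt.sub hf hg

theorem SmoothFunAt.mul {f g : M → ℝ} {x : M} (hf : SmoothFunAt n f x) (hg : SmoothFunAt n g x) :
    SmoothFunAt n (fun y => f y * g y) x :=
  ContMDiffAt.mul hf hg

theorem SmoothFunAt.const (r : ℝ) (x : M) : SmoothFunAt n (fun _ => r) x :=
  contMDiffAt_const

theorem SmoothFunAt.sum {κ : Type*} {s : Finset κ} {f : κ → M → ℝ} {x : M}
    (hf : ∀ i ∈ s, SmoothFunAt n (f i) x) : SmoothFunAt n (fun y => ∑ i ∈ s, f i y) x :=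
  contMDiffAt_finsetSum hf

theorem SmoothFunAt.prod {κ : Type*} {s : Finset κ} {f : κ → M → ℝ} {x : M}
    (hf : ∀ i ∈ s, SmoothFunAt n (f i) x) : SmoothFunAt n (fun y => ∏ i ∈ s, f i y) x :=
  contMDiffAt_finsetProd hf

theorem SmoothFunAt.comp {φ : ℝ → ℝ} {f : M → ℝ} {x : M} (hφ : ContDiffAt ℝ ∞ φ (f x))
    (hf : SmoothFunAt n f x) : SmoothFunAt n (fun y => φ (f y)) x :=
  ContMDiffAt.comp x (contMDiffAt_iff_contDiffAt.2 hφ) hf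

theorem SmoothFunAt.inv {f : M → ℝ} {x : M} (hf : SmoothFunAt n f x) (h : f x ≠ 0) :
    SmoothFunAt n (fun y => (f y)⁻¹) x :=
  SmoothFunAt.comp (contDiffAt_inv ℝ h) hf

theorem SmoothFunAt.congr {f g : M → ℝ} {x : M} (hf : SmoothFunAt n f x)
    (h : g =ᶠ[nhds x] f) : SmoothFunAt n g x :=
  ContMDiffAt.congr_of_eventuallyEq hf h

theorem SmoothFunAt.det {ι : Type*} [Fintype ι] [DecidableEq ι] {A : M → Matrix ι ι ℝ} {x : M}
    (hA : ∀ i j, SmoothFunAt n (fun y => A y i j) x) : SmoothFunAt n (fun y => (A y).det) x := by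
  simp only [Matrix.det_apply']
  exact SmoothFunAt.sum fun σ _ => SmoothFunAt.mul (SmoothFunAt.const _ _)
    (SmoothFunAt.prod fun i _ => hA _ _)

/-- Cramer's rule: each entry of the inverse is a determinant divided by a nonvanishing determinant.
-/
theorem SmoothFunAt.matrix_inv {ι : Type*} [Fintype ι] [DecidableEq ι] {A : M → Matrix ι ι ℝ}
    {x : M} (hA : ∀ i j, SmoothFunAt n (fun y => A y i j) x) (h : (A x).det ≠ 0) (i j : ι) :
    SmoothFunAt n (fun y => (A y)⁻¹ i j) x := by
  simp only [Matrix.inv_def, Matrix.smul_apply, Ring.inverse_eq_inv', smul_eq_mul,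
    Matrix.adjugate_apply]
  refine SmoothFunAt.mul (SmoothFunAt.inv (SmoothFunAt.det hA) h) (SmoothFunAt.det fun k l => ?_)
  by_cases hk : k = j
  · subst hk
    simpa using SmoothFunAt.const _ _
  · simpa [Matrix.updateRow_ne hk] using hA k l

theorem SmoothFieldAt.smul {f : M → ℝ} {Y : Π x : M, TangentSpace (𝓡 n) x} {x : M}
    (hf : SmoothFunAt n f x) (hY : SmoothFieldAt Y x) : SmoothFieldAt (f • Y) x :=
  ContMDiffAt.smul_section hf hY

theorem SmoothFieldAt.frameCoeff {c x : M} (hx : x ∈ (extChartAt (𝓡 n) c).source)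
    {Y : Π x : M, TangentSpace (𝓡 n) x} (hY : SmoothFieldAt Y x) (i : Fin n) :
    SmoothFunAt n (fun y => frameCoeff c i y (Y y)) x :=
  (contMDiffAt_iff_frameCoeff hx).1 hY i

theorem eventually_mem_source {c x : M} (hx : x ∈ (extChartAt (𝓡 n) c).source) :
    ∀ᶠ y in nhds x, y ∈ (extChartAt (𝓡 n) c).source :=
  (isOpen_extChartAt_source (I := 𝓡 n) c).mem_nhds hx

theorem SmoothFieldAt.mvfderiv {f : M → ℝ} {Y : Π x : M, TangentSpace (𝓡 n) x} {x : M}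
    (hf : SmoothFunAt n f x) (hY : SmoothFieldAt Y x) :
    SmoothFunAt n (fun y => mvfderiv (𝓡 n) f y (Y y)) x := by
  have hx := mem_extChartAt_source (I := 𝓡 n) x
  refine SmoothFunAt.congr (SmoothFunAt.sum (s := Finset.univ) fun i _ =>
    SmoothFunAt.mul (hY.frameCoeff hx i) (contMDiffAt_mvfderiv_frame hx i hf)) ?_
  filter_upwards [eventually_mem_source hx] with y hy
  conv_lhs => rw [← sum_frameCoeff_smul hy (Y y), map_sum]
  simp

variable [RiemannianBundle (fun x : M => TangentSpace (𝓡 n) x)]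
  [IsContMDiffRiemannianBundle (𝓡 n) ∞ (EuclideanSpace ℝ (Fin n))
      (fun x : M => TangentSpace (𝓡 n) x)]

theorem SmoothFieldAt.inner {X Y : Π x : M, TangentSpace (𝓡 n) x} {x : M}
    (hX : SmoothFieldAt X x) (hY : SmoothFieldAt Y x) :
    SmoothFunAt n (fun y => (inner ℝ (X y) (Y y) : ℝ)) x :=
  ContMDiffAt.inner_bundle (IB := 𝓡 n) (F := EuclideanSpace ℝ (Fin n))
    (E := fun x : M => TangentSpace (𝓡 n) x) hX hY

variable (n) in
/-- The Gram matrix of the coordinate frame of the chart at `c`. -/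
def frameGram (c x : M) : Matrix (Fin n) (Fin n) ℝ := Matrix.gram ℝ fun i => frame c i x

theorem frameGram_eq {c x : M} (hx : x ∈ (extChartAt (𝓡 n) c).source) :
    frameGram n c x = Matrix.gram ℝ (frameBasis c hx) := by
  ext i j
  simp [frameGram, Matrix.gram_apply, frameBasis_apply]

theorem det_frameGram_pos {c x : M} (hx : x ∈ (extChartAt (𝓡 n) c).source) :
    0 < (frameGram n c x).det := by
  rw [frameGram_eq hx]
  have h := Matrix.posDef_gram_of_linearIndependent (𝕜 := ℝ) (frameBasis c hx).linearIndependent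
  exact h.det_pos

theorem frameGram_symm {c : M} {z : EuclideanSpace ℝ (Fin n)}
    (hz : z ∈ (extChartAt (𝓡 n) c).target) :
    frameGram n c ((extChartAt (𝓡 n) c).symm z) = gramMatrix c z := by
  ext i j
  rw [frameGram, Matrix.gram_apply, frame_symm hz, frame_symm hz]
  rfl

theorem smooth_frameGram {c x : M} (hx : x ∈ (extChartAt (𝓡 n) c).source) (i j : Fin n) :
    SmoothFunAt n (fun y => frameGram n c y i j) x :=
  (contMDiffAt_frame hx i).inner (contMDiffAt_frame hx j)

theorem smooth_frameGram_inv {c x : M} (hx : x ∈ (extChartAt (𝓡 n) c).source) (i j : Fin n) :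
    SmoothFunAt n (fun y => (frameGram n c y)⁻¹ i j) x :=
  SmoothFunAt.matrix_inv (smooth_frameGram hx) (det_frameGram_pos hx).ne' i j

theorem inner_grad (f : M → ℝ) (x : M) (v : TangentSpace (𝓡 n) x) :
    inner ℝ (grad (𝓡 n) f x) v = mvfderiv (𝓡 n) f x v := by
  rw [grad, InnerProductSpace.toDual_symm_apply]

theorem smooth_grad {f : M → ℝ} {x : M} (hf : SmoothFunAt n f x) :
    SmoothFieldAt (grad (𝓡 n) f) x := by
  have hx := mem_extChartAt_source (I := 𝓡 n) x
  refine (contMDiffAt_iff_frameCoeff hx).2 fun i => ?_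
  refine SmoothFunAt.congr (SmoothFunAt.sum (s := Finset.univ) fun j _ => SmoothFunAt.mul
    (smooth_frameGram_inv hx i j) (contMDiffAt_mvfderiv_frame hx j hf)) ?_
  filter_upwards [eventually_mem_source hx] with y hy
  rw [frameCoeff_eq_repr hy, repr_eq_sum_gram_inv, frameGram_eq hy]
  simp [inner_grad, frameBasis_apply]

theorem SmoothFieldAt.mlieBracket {X Y : Π x : M, TangentSpace (𝓡 n) x} {x : M}
    (hX : SmoothFieldAt X x) (hY : SmoothFieldAt Y x) :
    SmoothFieldAt (VectorField.mlieBracket (𝓡 n) X Y) x := by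
  have : IsManifold (𝓡 n) (minSmoothness ℝ 2) M := by
    rw [minSmoothness_of_isRCLikeNormedField]
    exact IsManifold.of_le (n := ∞) ENat.LEInfty.out
  -- The bracket costs one derivative, which is harmless because `∞ + 1 = ∞`.
  have : IsManifold (𝓡 n) (((⊤ : ℕ∞) : WithTop ℕ∞) + 1) M := ‹IsManifold (𝓡 n) ∞ M›
  exact ContMDiffAt.mlieBracket_vectorField (n := ⊤) (m := ⊤) hX hY
    (by rw [minSmoothness_of_isRCLikeNormedField]; exact le_rfl)

theorem SmoothFieldAt.eventually_diff {Y : Π x : M, TangentSpace (𝓡 n) x} {x : M}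
    (h : SmoothFieldAt Y x) : ∀ᶠ y in nhds x, DiffFieldAt Y y := by
  have h1 := ContMDiffAt.of_le (n := ∞) (m := 1) h (by simp)
  filter_upwards [(contMDiffAt_iff_contMDiffAt_nhds (by simp)).1 h1] with y hy
  exact hy.mdifferentiableAt (by simp)

theorem smooth_inner_leviCivita {X Y Z : Π x : M, TangentSpace (𝓡 n) x} {x : M}
    (hX : SmoothFieldAt X x) (hY : SmoothFieldAt Y x) (hZ : SmoothFieldAt Z x) :
    SmoothFunAt n (fun y => (inner ℝ (leviCivita (𝓡 n) M Y y (X y)) (Z y) : ℝ)) x := by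
  have h : SmoothFunAt n (koszul (𝓡 n) X Y Z) x := by
    unfold koszul
    simp only [div_eq_mul_inv]
    exact SmoothFunAt.mul (SmoothFunAt.sub (SmoothFunAt.sub (SmoothFunAt.add (SmoothFunAt.sub
      (SmoothFunAt.add (hX.mvfderiv (hY.inner hZ)) (hY.mvfderiv (hX.inner hZ)))
      (hZ.mvfderiv (hX.inner hY))) ((hX.mlieBracket hY).inner hZ))
      ((hX.mlieBracket hZ).inner hY)) ((hY.mlieBracket hZ).inner hX)) (SmoothFunAt.const _ _)
  refine h.congr ?_
  -- The Koszul identity is needed on a neighbourhood, and it is available only at points where the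
  -- fields are differentiable.
  filter_upwards [hX.eventually_diff, hY.eventually_diff, hZ.eventually_diff] with y h1 h2 h3
  exact inner_leviCivitaAux h1 h2 h3

/-- The divergence of a vector field, the trace of its covariant derivative. -/
def divergence (Y : Π x : M, TangentSpace (𝓡 n) x) (x : M) : ℝ :=
  LinearMap.trace ℝ (TangentSpace (𝓡 n) x)
    (leviCivita (𝓡 n) M Y x : TangentSpace (𝓡 n) x →ₗ[ℝ] TangentSpace (𝓡 n) x)

theorem smooth_divergence {Y : Π x : M, TangentSpace (𝓡 n) x} {x : M} (hY : SmoothFieldAt Y x) :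
    SmoothFunAt n (divergence Y) x := by
  have hx := mem_extChartAt_source (I := 𝓡 n) x
  refine SmoothFunAt.congr (SmoothFunAt.sum (s := Finset.univ) fun i _ =>
    SmoothFunAt.sum (s := Finset.univ) fun j _ => SmoothFunAt.mul (smooth_frameGram_inv hx i j)
      (smooth_inner_leviCivita (contMDiffAt_frame hx i) hY (contMDiffAt_frame hx j))) ?_
  filter_upwards [eventually_mem_source hx] with y hy
  rw [divergence, trace_eq_sum_gram_inv (frameBasis x hy), frameGram_eq hy]
  simp [frameBasis_apply]

theorem smooth_endNormSq_leviCivita {Y : Π x : M, TangentSpace (𝓡 n) x} {x : M}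
    (hY : SmoothFieldAt Y x) : SmoothFunAt n (fun y => endNormSq (leviCivita (𝓡 n) M Y y)) x := by
  have hx := mem_extChartAt_source (I := 𝓡 n) x
  have h (i k : Fin n) := smooth_inner_leviCivita (contMDiffAt_frame hx i) hY
    (contMDiffAt_frame hx k)
  refine SmoothFunAt.congr (SmoothFunAt.sum (s := Finset.univ) fun i _ =>
    SmoothFunAt.sum (s := Finset.univ) fun j _ => SmoothFunAt.mul (smooth_frameGram_inv hx i j)
      -- One inverse Gram matrix comes from the trace, the second from expanding the inner product
      -- of two images in the frame.
      (SmoothFunAt.sum (s := Finset.univ) fun k _ => SmoothFunAt.sum (s := Finset.univ) fun l _ =>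
        SmoothFunAt.mul (SmoothFunAt.mul (smooth_frameGram_inv hx k l) (h i l)) (h j k))) ?_
  filter_upwards [eventually_mem_source hx] with y hy
  rw [endNormSq, trace_adjoint_comp_eq_sum (frameBasis x hy), frameGram_eq hy]
  refine Finset.sum_congr rfl fun i _ => Finset.sum_congr rfl fun j _ => ?_
  rw [inner_eq_sum_gram_inv (frameBasis x hy)]
  simp only [frameBasis_apply]

end MetricSmoothness

/-! ### The divergence in coordinates. -/

section LocalDivergence

variable {n : ℕ} {M : Type*} [TopologicalSpace M] [ChartedSpace (EuclideanSpace ℝ (Fin n)) M]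
  [IsManifold (𝓡 n) ∞ M]
  [RiemannianBundle (fun x : M => TangentSpace (𝓡 n) x)]
  [IsContMDiffRiemannianBundle (𝓡 n) ∞ (EuclideanSpace ℝ (Fin n))
      (fun x : M => TangentSpace (𝓡 n) x)]

theorem leviCivita_smul {f : M → ℝ} {Y : Π x : M, TangentSpace (𝓡 n) x} {x : M}
    (hf : DiffFunAt n f x) (hY : DiffFieldAt Y x) :
    leviCivita (𝓡 n) M (f • Y) x =
      f x • leviCivita (𝓡 n) M Y x + (mvfderiv (𝓡 n) f x).smulRight (Y x) :=
  (leviCivita (𝓡 n) M).isCovariantDerivativeOnUniv.leibniz hY hf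

theorem leviCivita_add {X Y : Π x : M, TangentSpace (𝓡 n) x} {x : M}
    (hX : DiffFieldAt X x) (hY : DiffFieldAt Y x) :
    leviCivita (𝓡 n) M (X + Y) x = leviCivita (𝓡 n) M X x + leviCivita (𝓡 n) M Y x :=
  (leviCivita (𝓡 n) M).isCovariantDerivativeOnUniv.add hX hY

theorem leviCivita_congr {X Y : Π x : M, TangentSpace (𝓡 n) x} {x : M}
    (hX : DiffFieldAt X x) (hY : DiffFieldAt Y x) (h : ∀ᶠ y in nhds x, X y = Y y) :
    leviCivita (𝓡 n) M X x = leviCivita (𝓡 n) M Y x :=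
  (leviCivita (𝓡 n) M).isCovariantDerivativeOnUniv.congr_of_eventuallyEq hX hY
    Filter.univ_mem h

theorem diffFieldAt_sum {κ : Type*} {s : Finset κ} {Y : κ → Π x : M, TangentSpace (𝓡 n) x} {x : M}
    (hY : ∀ i ∈ s, DiffFieldAt (Y i) x) : DiffFieldAt (∑ i ∈ s, Y i) x := by
  classical
  induction s using Finset.induction_on with
  | empty =>
    rw [Finset.sum_empty]
    exact mdifferentiableAt_zeroSection ..
  | insert a s ha ih =>
    rw [Finset.sum_insert ha]
    exact mdifferentiableAt_add_section (hY a (Finset.mem_insert_self a s))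
      (ih fun i hi => hY i (Finset.mem_insert_of_mem hi))

theorem divergence_sum {κ : Type*} {s : Finset κ} {Y : κ → Π x : M, TangentSpace (𝓡 n) x} {x : M}
    (hY : ∀ i ∈ s, DiffFieldAt (Y i) x) :
    divergence (∑ i ∈ s, Y i) x = ∑ i ∈ s, divergence (Y i) x := by
  classical
  induction s using Finset.induction_on with
  | empty => simp [divergence]
  | insert a s ha ih =>
    have hs : ∀ i ∈ s, DiffFieldAt (Y i) x := fun i hi => hY i (Finset.mem_insert_of_mem hi)
    rw [Finset.sum_insert ha, Finset.sum_insert ha, ← ih hs, divergence,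
      leviCivita_add (hY a (Finset.mem_insert_self a s)) (diffFieldAt_sum hs)]
    simp [divergence]

theorem divergence_smul {f : M → ℝ} {Y : Π x : M, TangentSpace (𝓡 n) x} {x : M}
    (hf : DiffFunAt n f x) (hY : DiffFieldAt Y x) :
    divergence (f • Y) x = f x * divergence Y x + mvfderiv (𝓡 n) f x (Y x) := by
  rw [divergence, leviCivita_smul hf hY]
  rw [ContinuousLinearMap.toLinearMap_add, map_add]
  congr 1
  · simp [divergence]
  · exact LinearMap.trace_smulRight _ _

theorem divergence_congr {X Y : Π x : M, TangentSpace (𝓡 n) x} {x : M}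
    (hX : DiffFieldAt X x) (hY : DiffFieldAt Y x) (h : ∀ᶠ y in nhds x, X y = Y y) :
    divergence X x = divergence Y x := by
  rw [divergence, leviCivita_congr hX hY h, divergence]

/-- The divergence of a coordinate vector field, by the Koszul formula. -/
theorem divergence_frame {c x : M} (hx : x ∈ (extChartAt (𝓡 n) c).source) (k : Fin n) :
    divergence (frame c k) x = (∑ i, ∑ j, (frameGram n c x)⁻¹ i j *
      mvfderiv (𝓡 n) (fun y => frameGram n c y i j) x (frame c k x)) / 2 := by
  have hsymm : ∀ i j, (frameGram n c x)⁻¹ i j = (frameGram n c x)⁻¹ j i := by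
    intro i j
    have h : (frameGram n c x).IsSymm := by
      have := Matrix.isHermitian_gram ℝ (fun i => frame (n := n) c i x)
      simpa [Matrix.IsHermitian, Matrix.IsSymm, frameGram] using this
    exact (h.inv).apply j i
  have hA : ∀ i j, inner ℝ (leviCivita (𝓡 n) M (frame c k) x (frame c i x)) (frame c j x) =
      (mvfderiv (𝓡 n) (fun y => frameGram n c y k j) x (frame c i x)
        + mvfderiv (𝓡 n) (fun y => frameGram n c y i j) x (frame c k x)
        - mvfderiv (𝓡 n) (fun y => frameGram n c y k i) x (frame c j x)) / 2 := by
    intro i j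
    have h := inner_leviCivitaAux (mdifferentiableAt_frame hx i) (mdifferentiableAt_frame hx k)
      (mdifferentiableAt_frame hx j)
    refine Eq.trans h ?_
    rw [koszul, mlieBracket_frame hx, mlieBracket_frame hx, mlieBracket_frame hx,
      mvfderiv_inner_comm x (frame c i) (frame c k)]
    simp only [inner_zero_left]
    simp [frameGram, Matrix.gram_apply]
  have h0 : divergence (frame c k) x = ∑ i, ∑ j, (frameGram n c x)⁻¹ i j *
      inner ℝ (leviCivita (𝓡 n) M (frame c k) x (frame c i x)) (frame c j x) := by
    rw [divergence, trace_eq_sum_gram_inv (frameBasis c hx), frameGram_eq hx]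
    simp [frameBasis_apply]
  -- The first and last Koszul terms are exchanged by `i ↔ j`, so they cancel against the symmetric
  -- inverse Gram matrix; only `½ tr (g⁻¹ ∂ₖ g)` survives.
  have h1 : ∑ i, ∑ j, (frameGram n c x)⁻¹ i j *
      mvfderiv (𝓡 n) (fun y => frameGram n c y k j) x (frame c i x) =
      ∑ i, ∑ j, (frameGram n c x)⁻¹ i j *
        mvfderiv (𝓡 n) (fun y => frameGram n c y k i) x (frame c j x) := by
    rw [Finset.sum_comm]
    exact Finset.sum_congr rfl fun i _ => Finset.sum_congr rfl fun j _ => by rw [hsymm]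
  rw [h0]
  simp only [hA, mul_div_assoc', mul_sub, mul_add, sub_div, add_div, Finset.sum_add_distrib,
    Finset.sum_sub_distrib, ← Finset.sum_div]
  rw [h1]
  ring

variable (n) in
/-- The density of the Riemannian volume in the chart at `c`. -/
def density (c x : M) : ℝ := √(frameGram n c x).det

theorem smooth_density {c x : M} (hx : x ∈ (extChartAt (𝓡 n) c).source) :
    SmoothFunAt n (density n c) x :=
  SmoothFunAt.comp (Real.contDiffAt_sqrt (det_frameGram_pos hx).ne')
    (SmoothFunAt.det (smooth_frameGram hx))

theorem mvfderiv_det_frameGram {c x : M} (hx : x ∈ (extChartAt (𝓡 n) c).source) (k : Fin n) :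
    mvfderiv (𝓡 n) (fun y => (frameGram n c y).det) x (frame c k x) =
      (frameGram n c x).det * ∑ i, ∑ j, (frameGram n c x)⁻¹ i j *
        mvfderiv (𝓡 n) (fun y => frameGram n c y i j) x (frame c k x) := by
  -- A derivative along `∂ₖ` is the derivative along the `k`-th coordinate line, which reduces the
  -- claim to Jacobi's formula for a curve of matrices.
  have hline : ∀ {f : M → ℝ}, SmoothFunAt n f x → HasDerivAt (fun s : ℝ =>
      f ((extChartAt (𝓡 n) c).symm (extChartAt (𝓡 n) c x + s • EuclideanSpace.single k (1 : ℝ))))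
      (mvfderiv (𝓡 n) f x (frame c k x)) 0 := by
    intro f hf
    rw [mvfderiv_frame hx k hf.diff]
    have h1 : DifferentiableAt ℝ (f ∘ (extChartAt (𝓡 n) c).symm) (extChartAt (𝓡 n) c x) := by
      refine (contDiffAt_comp_symm ((extChartAt (𝓡 n) c).map_source hx) ?_).differentiableAt
        (by simp)
      rwa [(extChartAt (𝓡 n) c).left_inv hx]
    exact h1.hasFDerivAt.hasLineDerivAt _
  have hx0 : (extChartAt (𝓡 n) c).symm (extChartAt (𝓡 n) c x +
      (0 : ℝ) • EuclideanSpace.single k (1 : ℝ)) = x := by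
    rw [zero_smul, add_zero, (extChartAt (𝓡 n) c).left_inv hx]
  have h2 := hasDerivAt_det (A := fun s : ℝ => frameGram n c ((extChartAt (𝓡 n) c).symm
      (extChartAt (𝓡 n) c x + s • EuclideanSpace.single k (1 : ℝ))))
    (A' := Matrix.of fun i j => mvfderiv (𝓡 n) (fun y => frameGram n c y i j) x (frame c k x))
    (t := 0) (fun i j => hline (smooth_frameGram hx i j))
    (by rw [hx0]; exact isUnit_iff_ne_zero.2 (det_frameGram_pos hx).ne')
  rw [hx0] at h2
  rw [(hline (SmoothFunAt.det (smooth_frameGram hx))).unique h2]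
  congr 1
  rw [Matrix.trace]
  refine Finset.sum_congr rfl fun i _ => ?_
  rw [Matrix.diag_apply, Matrix.mul_apply]
  refine Finset.sum_congr rfl fun j _ => ?_
  rw [Matrix.of_apply]
  congr 2
  simp only [frameGram, Matrix.gram_apply]
  exact mvfderiv_inner_comm x (frame c j) (frame c i)

theorem mvfderiv_comp_real {φ : ℝ → ℝ} {f : M → ℝ} {x : M} {φ' : ℝ} (hφ : HasDerivAt φ φ' (f x))
    (hf : DiffFunAt n f x) (v : TangentSpace (𝓡 n) x) :
    mvfderiv (𝓡 n) (fun y => φ (f y)) x v = φ' * mvfderiv (𝓡 n) f x v := by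
  have h := mvfderiv_comp (g := φ) (f := f) x hφ.differentiableAt.mdifferentiableAt hf
  refine (DFunLike.congr_fun h v).trans ?_
  change mfderiv 𝓘(ℝ, ℝ) 𝓘(ℝ, ℝ) φ (f x) (mfderiv (𝓡 n) 𝓘(ℝ, ℝ) f x v) = _
  rw [mfderiv_eq_fderiv, hφ.hasFDerivAt.fderiv]
  exact mul_comm (mvfderiv (𝓡 n) f x v) φ'

/-- Jacobi's formula gives `∂ₖ √det g = √det g · ½ tr (g⁻¹ ∂ₖ g)`, and the half trace is exactly the
divergence of `∂ₖ`. -/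
theorem mvfderiv_density {c x : M} (hx : x ∈ (extChartAt (𝓡 n) c).source) (k : Fin n) :
    mvfderiv (𝓡 n) (density n c) x (frame c k x) =
      density n c x * divergence (frame c k) x := by
  have hpos := det_frameGram_pos (n := n) hx
  have h : mvfderiv (𝓡 n) (density n c) x (frame c k x) = _ :=
    mvfderiv_comp_real (f := fun y => (frameGram n c y).det) (Real.hasDerivAt_sqrt hpos.ne')
      (SmoothFunAt.det (smooth_frameGram hx)).diff (frame c k x)
  rw [h, mvfderiv_det_frameGram hx, divergence_frame hx, density]
  have := Real.mul_self_sqrt hpos.le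
  have h2 := Real.sqrt_pos.2 hpos
  field_simp
  rw [sq, this]

/-- The coordinate expression of the divergence. -/
theorem density_mul_divergence {c x : M} (hx : x ∈ (extChartAt (𝓡 n) c).source)
    {Y : Π x : M, TangentSpace (𝓡 n) x} (hY : SmoothFieldAt Y x) :
    density n c x * divergence Y x = ∑ k, mvfderiv (𝓡 n)
      (fun y => density n c y * frameCoeff c k y (Y y)) x (frame c k x) := by
  have hc := fun k => hY.frameCoeff hx k
  have hd : ∀ k ∈ Finset.univ, DiffFieldAt ((fun y => frameCoeff c k y (Y y)) • frame c k) x :=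
    fun k _ => ((contMDiffAt_frame hx k).smul (hc k)).diff
  have h1 : divergence Y x = divergence (∑ k, (fun y => frameCoeff c k y (Y y)) • frame c k) x := by
    refine divergence_congr hY.diff (diffFieldAt_sum hd) ?_
    filter_upwards [eventually_mem_source hx] with y hy
    simp [Finset.sum_apply, sum_frameCoeff_smul hy]
  rw [h1, divergence_sum hd, Finset.mul_sum]
  refine Finset.sum_congr rfl fun k _ => ?_
  rw [divergence_smul (hc k).diff (mdifferentiableAt_frame hx k)]
  have h2 := DFunLike.congr_fun (mvfderiv_mul (smooth_density hx).diff (hc k).diff) (frame c k x)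
  refine Eq.trans ?_ h2.symm
  simp only [add_apply, smul_apply, smul_eq_mul, mvfderiv_density hx]
  ring

end LocalDivergence

/-! ### The Riemannian volume in a chart. -/

section VolumeMeasure

variable {n : ℕ} {M : Type*} [TopologicalSpace M] [ChartedSpace (EuclideanSpace ℝ (Fin n)) M]
  [IsManifold (𝓡 n) ∞ M]
  [RiemannianBundle (fun x : M => TangentSpace (𝓡 n) x)]
  [IsContMDiffRiemannianBundle (𝓡 n) ∞ (EuclideanSpace ℝ (Fin n))
      (fun x : M => TangentSpace (𝓡 n) x)]
  [MeasurableSpace M] [BorelSpace M]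

variable (n) in
theorem measurableSet_target (c : M) : MeasurableSet (extChartAt (𝓡 n) c).target :=
  (isOpen_extChartAt_target c).measurableSet

variable (n) in
theorem measurableSet_source (c : M) : MeasurableSet (extChartAt (𝓡 n) c).source :=
  (isOpen_extChartAt_source c).measurableSet

theorem aemeasurable_extChartAt_symm (c : M) : AEMeasurable (extChartAt (𝓡 n) c).symm
    ((volume.restrict (extChartAt (𝓡 n) c).target).withDensity
      fun z => ENNReal.ofReal √(gramMatrix c z).det) :=
  AEMeasurable.mono_ac
    ((continuousOn_extChartAt_symm c).aemeasurable (measurableSet_target n c))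
    (withDensity_absolutelyContinuous _ _)

theorem chartVolume_apply (c : M) {s : Set M} (hs : MeasurableSet s) :
    chartVolume (n := n) c s =
      ∫⁻ z in (extChartAt (𝓡 n) c).symm ⁻¹' s ∩ (extChartAt (𝓡 n) c).target,
        ENNReal.ofReal √(gramMatrix c z).det := by
  rw [chartVolume, Measure.map_apply_of_aemeasurable (aemeasurable_extChartAt_symm c) hs,
    withDensity_apply', Measure.restrict_restrict' (measurableSet_target n c)]

theorem chartVolume_apply_inter_source (c : M) {s : Set M} (hs : MeasurableSet s) :
    chartVolume (n := n) c (s ∩ (extChartAt (𝓡 n) c).source) = chartVolume (n := n) c s := by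
  rw [chartVolume_apply c hs, chartVolume_apply c (hs.inter (measurableSet_source n c))]
  congr 2
  ext z
  simp only [Set.mem_inter_iff, Set.mem_preimage, and_congr_left_iff, and_iff_left_iff_imp]
  exact fun hz _ => (extChartAt (𝓡 n) c).map_target hz

/-- The Jacobian matrix of the change of coordinates between the charts at `c'` and `c`. -/
def transitionMatrix (c c' x : M) : Matrix (Fin n) (Fin n) ℝ :=
  Matrix.of fun k i => frameCoeff c k x (frame c' i x)

theorem frameGram_transition {c c' x : M} (hx : x ∈ (extChartAt (𝓡 n) c).source) :
    frameGram n c' x =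
      (transitionMatrix c c' x).transpose * frameGram n c x * transitionMatrix c c' x := by
  ext i j
  rw [frameGram, Matrix.gram_apply]
  conv_lhs => rw [← sum_frameCoeff_smul hx (frame c' i x), ← sum_frameCoeff_smul hx (frame c' j x)]
  simp only [sum_inner, inner_sum, inner_smul_left, inner_smul_right, RCLike.conj_to_real,
    Matrix.mul_apply, Finset.sum_mul]
  refine Finset.sum_congr rfl fun k _ => ?_
  rw [Finset.mul_sum]
  refine Finset.sum_congr rfl fun l _ => ?_
  simp only [frameGram, Matrix.gram_apply, transitionMatrix, Matrix.transpose_apply,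
    Matrix.of_apply]
  ring

/-- Gram matrices transform by `g' = Jᵀ g J`, so `√det` acquires the factor `|det J|` demanded by
the change of variables formula. -/
theorem density_transition {c c' x : M} (hx : x ∈ (extChartAt (𝓡 n) c).source) :
    density n c' x = |(transitionMatrix (n := n) c c' x).det| * density n c x := by
  rw [density, density, frameGram_transition hx, Matrix.det_mul, Matrix.det_mul,
    Matrix.det_transpose, mul_right_comm, ← sq, Real.sqrt_mul (sq_nonneg _), Real.sqrt_sq_eq_abs]

theorem differentiableAt_transition {c c' : M} {z : EuclideanSpace ℝ (Fin n)}
    (hz : z ∈ (extChartAt (𝓡 n) c').target)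
    (hzc : (extChartAt (𝓡 n) c').symm z ∈ (extChartAt (𝓡 n) c).source) :
    DifferentiableAt ℝ (extChartAt (𝓡 n) c ∘ (extChartAt (𝓡 n) c').symm) z := by
  rw [← mdifferentiableAt_iff_differentiableAt]
  exact (mdifferentiableAt_extChartAt (by rwa [extChartAt_source] at hzc)).comp z
    (mdifferentiableAt_extChartAt_symm' hz)

theorem det_fderiv_transition {c c' : M} {z : EuclideanSpace ℝ (Fin n)}
    (hz : z ∈ (extChartAt (𝓡 n) c').target)
    (hzc : (extChartAt (𝓡 n) c').symm z ∈ (extChartAt (𝓡 n) c).source) :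
    (fderiv ℝ (extChartAt (𝓡 n) c ∘ (extChartAt (𝓡 n) c').symm) z).det =
      (transitionMatrix (n := n) c c' ((extChartAt (𝓡 n) c').symm z)).det := by
  rw [ContinuousLinearMap.det,
    ← LinearMap.det_toMatrix (EuclideanSpace.basisFun (Fin n) ℝ).toBasis]
  congr 1
  ext k i
  have h1 : fderiv ℝ (extChartAt (𝓡 n) c ∘ (extChartAt (𝓡 n) c').symm) z
      (EuclideanSpace.single i 1) = ∑ k, transitionMatrix c c' ((extChartAt (𝓡 n) c').symm z) k i •
        EuclideanSpace.single k (1 : ℝ) := by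
    rw [← mfderiv_eq_fderiv, mfderiv_comp z
      (mdifferentiableAt_extChartAt (by rwa [extChartAt_source] at hzc))
      (mdifferentiableAt_extChartAt_symm' hz)]
    change mfderiv (𝓡 n) 𝓘(ℝ, EuclideanSpace ℝ (Fin n)) (extChartAt (𝓡 n) c)
      ((extChartAt (𝓡 n) c').symm z) (coordVector c' z i) = _
    rw [← frame_symm hz]
    conv_lhs => rw [← sum_frameCoeff_smul hzc (frame c' i _), map_sum]
    refine Finset.sum_congr rfl fun k _ => ?_
    rw [map_smul, mfderiv_extChartAt_frame hzc]
    rfl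
  rw [LinearMap.toMatrix_apply]
  simp only [OrthonormalBasis.coe_toBasis, EuclideanSpace.basisFun_apply,
    ContinuousLinearMap.coe_coe, OrthonormalBasis.coe_toBasis_repr_apply,
    EuclideanSpace.basisFun_repr, h1]
  simp [Finset.sum_apply, Pi.single_apply]

/-- Two chart volumes agree on the overlap of the chart domains. -/
theorem chartVolume_eq_of_subset {c c' : M} {s : Set M} (hs : MeasurableSet s)
    (hsc : s ⊆ (extChartAt (𝓡 n) c).source) (hsc' : s ⊆ (extChartAt (𝓡 n) c').source) :
    chartVolume (n := n) c s = chartVolume (n := n) c' s := by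
  set A := (extChartAt (𝓡 n) c').symm ⁻¹' s ∩ (extChartAt (𝓡 n) c').target with hA
  have hAm : MeasurableSet A := by
    have h := (continuousOn_iff_continuous_domRestrict.1
      (continuousOn_extChartAt_symm (I := 𝓡 n) c')).measurable hs
    convert (measurableSet_target n c').subtype_image h using 1
    ext z
    simp [hA, and_comm]
  have himg : (extChartAt (𝓡 n) c ∘ (extChartAt (𝓡 n) c').symm) '' A =
      (extChartAt (𝓡 n) c).symm ⁻¹' s ∩ (extChartAt (𝓡 n) c).target := by
    ext w
    constructor
    · rintro ⟨z, ⟨hz, hz'⟩, rfl⟩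
      have h := hsc hz
      refine ⟨?_, (extChartAt (𝓡 n) c).map_source h⟩
      simp only [Function.comp, Set.mem_preimage, (extChartAt (𝓡 n) c).left_inv h]
      exact hz
    · rintro ⟨hw, hw'⟩
      have h := hsc' hw
      refine ⟨extChartAt (𝓡 n) c' ((extChartAt (𝓡 n) c).symm w),
        ⟨?_, (extChartAt (𝓡 n) c').map_source h⟩, ?_⟩
      · simp only [Set.mem_preimage, (extChartAt (𝓡 n) c').left_inv h]
        exact hw
      · simp only [Function.comp, (extChartAt (𝓡 n) c').left_inv h,
          (extChartAt (𝓡 n) c).right_inv hw']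
  have hinj : Set.InjOn (extChartAt (𝓡 n) c ∘ (extChartAt (𝓡 n) c').symm) A := by
    intro z hz w hw h
    exact (extChartAt (𝓡 n) c').symm.injOn hz.2 hw.2
      ((extChartAt (𝓡 n) c).injOn (hsc hz.1) (hsc hw.1) h)
  rw [chartVolume_apply c hs, chartVolume_apply c' hs, ← hA, ← himg,
    lintegral_image_eq_lintegral_abs_det_fderiv_mul volume hAm (fun z hz =>
      (differentiableAt_transition hz.2 (hsc hz.1)).hasFDerivAt.hasFDerivWithinAt) hinj]
  refine setLIntegral_congr_fun hAm fun z hz => ?_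
  have hz1 : (extChartAt (𝓡 n) c').symm z ∈ (extChartAt (𝓡 n) c).source := hsc hz.1
  have h := density_transition (c' := c') hz1
  simp only [density] at h
  rw [frameGram_symm hz.2] at h
  have h2 := frameGram_symm ((extChartAt (𝓡 n) c).map_source hz1)
  rw [(extChartAt (𝓡 n) c).left_inv hz1] at h2
  rw [h2] at h
  simp only [Function.comp_apply]
  rw [h, ENNReal.ofReal_mul (abs_nonneg _), ← det_fderiv_transition hz.2 hz1]

/-- A supremum of measures is not computed set by set. Instead one exhibits an upper bound of all
chart volumes that agrees with `chartVolume c` inside the chart domain. -/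
theorem riemannianVolume_apply_of_subset {c : M} {s : Set M} (hs : MeasurableSet s)
    (hsc : s ⊆ (extChartAt (𝓡 n) c).source) :
    riemannianVolume n M s = chartVolume (n := n) c s := by
  refine le_antisymm ?_ (le_iSup (fun c : M => chartVolume (n := n) c) c s)
  -- Adding the largest measure off the chart domain dominates every other chart volume there, while
  -- overlaps are handled by `chartVolume_eq_of_subset`; the added term vanishes on `s`.
  have h : riemannianVolume n M ≤ chartVolume (n := n) c +
      (⊤ : Measure M).restrict (extChartAt (𝓡 n) c).sourceᶜ := by
    refine iSup_le fun c' => Measure.le_iff.2 fun t ht => ?_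
    rw [← measure_inter_add_sdiff t (measurableSet_source n c), Measure.add_apply]
    refine add_le_add ?_ ?_
    · have hm := ht.inter (measurableSet_source n c)
      rw [← chartVolume_apply_inter_source c' hm, ← chartVolume_eq_of_subset
        (hm.inter (measurableSet_source n c'))
        (Set.inter_subset_left.trans Set.inter_subset_right) Set.inter_subset_right]
      exact measure_mono (Set.inter_subset_left.trans Set.inter_subset_left)
    · rw [Measure.restrict_apply ht, ← Set.sdiff_eq]
      exact (le_top : chartVolume (n := n) c' ≤ ⊤) _
  refine (h s).trans (le_of_eq ?_)
  rw [Measure.add_apply, Measure.restrict_apply hs,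
    (Set.disjoint_compl_right_iff_subset.2 hsc).inter_eq, measure_empty, add_zero]

theorem riemannianVolume_restrict_source (c : M) :
    (riemannianVolume n M).restrict (extChartAt (𝓡 n) c).source = chartVolume (n := n) c := by
  ext s hs
  rw [Measure.restrict_apply hs, riemannianVolume_apply_of_subset
    (hs.inter (measurableSet_source n c)) Set.inter_subset_right,
    chartVolume_apply_inter_source c hs]

theorem continuousOn_sqrt_det_gramMatrix (c : M) :
    ContinuousOn (fun z => √(gramMatrix (n := n) c z).det) (extChartAt (𝓡 n) c).target := by
  intro z hz
  have h := (contDiffAt_comp_symm hz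
    (smooth_density ((extChartAt (𝓡 n) c).map_target hz))).continuousAt.continuousWithinAt
      (s := (extChartAt (𝓡 n) c).target)
  refine h.congr (fun w hw => ?_) ?_
  · rw [Function.comp_apply, density, frameGram_symm hw]
  · rw [Function.comp_apply, density, frameGram_symm hz]

/-- The continuous density is integrable over a closed coordinate ball. On compact `M` this makes
every smooth function integrable. -/
theorem isLocallyFiniteMeasure_riemannianVolume :
    IsLocallyFiniteMeasure (riemannianVolume n M) := by
  refine ⟨fun x => ?_⟩
  have hx := mem_extChartAt_source (I := 𝓡 n) x
  obtain ⟨r, hr, hball⟩ := Metric.nhds_basis_closedBall.mem_iff.1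
    ((isOpen_extChartAt_target (I := 𝓡 n) x).mem_nhds ((extChartAt (𝓡 n) x).map_source hx))
  have ho : IsOpen ((extChartAt (𝓡 n) x).source ∩
      extChartAt (𝓡 n) x ⁻¹' Metric.ball (extChartAt (𝓡 n) x x) r) :=
    (continuousOn_extChartAt x).isOpen_inter_preimage (isOpen_extChartAt_source x)
      Metric.isOpen_ball
  refine ⟨_, ho.mem_nhds ⟨hx, Metric.mem_ball_self hr⟩, ?_⟩
  rw [riemannianVolume_apply_of_subset ho.measurableSet Set.inter_subset_left,
    chartVolume_apply x ho.measurableSet]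
  refine (lintegral_mono_set (t := Metric.closedBall (extChartAt (𝓡 n) x x) r) ?_).trans_lt ?_
  · rintro z ⟨⟨_, hz⟩, hz'⟩
    simp only [Set.mem_preimage, (extChartAt (𝓡 n) x).right_inv hz'] at hz
    exact Metric.ball_subset_closedBall hz
  · have h := ((continuousOn_sqrt_det_gramMatrix x).mono hball).integrableOn_compact
      (μ := volume) (isCompact_closedBall _ _)
    exact h.lintegral_lt_top

theorem integral_chartVolume (c : M) {f : M → ℝ}
    (hf : AEStronglyMeasurable f (chartVolume (n := n) c)) :
    ∫ x, f x ∂(chartVolume (n := n) c) = ∫ z in (extChartAt (𝓡 n) c).target,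
      density n c ((extChartAt (𝓡 n) c).symm z) * f ((extChartAt (𝓡 n) c).symm z) := by
  rw [chartVolume, integral_map (aemeasurable_extChartAt_symm c) hf,
    integral_withDensity_eq_integral_toReal_smul₀
      ((continuousOn_sqrt_det_gramMatrix c).aemeasurable (measurableSet_target n c)).ennreal_ofReal
      (Filter.Eventually.of_forall fun _ => ENNReal.ofReal_lt_top)]
  refine setIntegral_congr_fun (measurableSet_target n c) fun z hz => ?_
  simp only [ENNReal.toReal_ofReal (Real.sqrt_nonneg _), smul_eq_mul, density, frameGram_symm hz]

end VolumeMeasure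

/-! ### The divergence theorem. -/

section DivergenceTheorem

/-- Integration by parts against the constant function `1`. -/
theorem integral_fderiv_apply_eq_zero {E : Type*} [NormedAddCommGroup E] [NormedSpace ℝ E]
    [FiniteDimensional ℝ E] [MeasurableSpace E] [BorelSpace E] (μ : Measure E) [μ.IsAddHaarMeasure]
    {f : E → ℝ} (hf : ContDiff ℝ 1 f) (hc : HasCompactSupport f) (v : E) :
    ∫ x, fderiv ℝ f x v ∂μ = 0 := by
  have h1 : Integrable (fun x => fderiv ℝ f x v) μ :=
    ((hf.continuous_fderiv one_ne_zero).clm_apply continuous_const).integrable_of_hasCompactSupport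
      (hc.fderiv_apply ℝ v)
  have h := integral_mul_fderiv_eq_neg_fderiv_mul_of_integrable (μ := μ) (f := fun _ : E => (1 : ℝ))
    (g := f) (v := v) (by simp) (by simpa using h1)
    (by simpa using hf.continuous.integrable_of_hasCompactSupport hc)
    (fun _ _ => differentiableAt_const _) (fun x _ => hf.differentiable one_ne_zero x)
  simpa using h

variable {n : ℕ} {M : Type*} [TopologicalSpace M] [ChartedSpace (EuclideanSpace ℝ (Fin n)) M]
  [IsManifold (𝓡 n) ∞ M]
  [RiemannianBundle (fun x : M => TangentSpace (𝓡 n) x)]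
  [IsContMDiffRiemannianBundle (𝓡 n) ∞ (EuclideanSpace ℝ (Fin n))
      (fun x : M => TangentSpace (𝓡 n) x)]

theorem continuous_of_smooth {f : M → ℝ} (hf : ∀ x, SmoothFunAt n f x) : Continuous f :=
  continuous_iff_continuousAt.2 fun x => ContMDiffAt.continuousAt (hf x)

variable [MeasurableSpace M] [BorelSpace M]

/-- Extension by zero of a function compactly supported in a chart domain, in coordinates. -/
theorem contDiff_indicator_comp_symm [T2Space M] {c : M} {K : Set M} (hK : IsCompact K)
    (hKc : K ⊆ (extChartAt (𝓡 n) c).source) {h : M → ℝ}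
    (hh : ∀ x ∈ (extChartAt (𝓡 n) c).source, SmoothFunAt n h x) (h0 : ∀ x ∉ K, h x = 0) :
    ContDiff ℝ ∞ ((extChartAt (𝓡 n) c).target.indicator (h ∘ (extChartAt (𝓡 n) c).symm)) ∧
    HasCompactSupport
      ((extChartAt (𝓡 n) c).target.indicator (h ∘ (extChartAt (𝓡 n) c).symm)) := by
  have hKi : IsCompact (extChartAt (𝓡 n) c '' K) :=
    hK.image_of_continuousOn ((continuousOn_extChartAt c).mono hKc)
  have hzero : ∀ z ∉ extChartAt (𝓡 n) c '' K,
      (extChartAt (𝓡 n) c).target.indicator (h ∘ (extChartAt (𝓡 n) c).symm) z = 0 := by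
    intro z hz
    by_cases hzt : z ∈ (extChartAt (𝓡 n) c).target
    · rw [Set.indicator_of_mem hzt]
      exact h0 _ fun hm => hz ⟨_, hm, (extChartAt (𝓡 n) c).right_inv hzt⟩
    · exact Set.indicator_of_notMem hzt _
  refine ⟨contDiff_iff_contDiffAt.2 fun z => ?_, HasCompactSupport.intro hKi hzero⟩
  by_cases hzt : z ∈ (extChartAt (𝓡 n) c).target
  · refine (contDiffAt_comp_symm hzt
      (hh _ ((extChartAt (𝓡 n) c).map_target hzt))).congr_of_eventuallyEq ?_
    filter_upwards [(isOpen_extChartAt_target (I := 𝓡 n) c).mem_nhds hzt] with w hw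
    exact Set.indicator_of_mem hw _
  -- Outside the target the point avoids the compact, hence closed, image of `K`, so the extension
  -- vanishes nearby.
  · refine (contDiffAt_const (c := (0 : ℝ))).congr_of_eventuallyEq ?_
    have hz : z ∉ extChartAt (𝓡 n) c '' K := by
      rintro ⟨x, hx, rfl⟩
      exact hzt ((extChartAt (𝓡 n) c).map_source (hKc hx))
    filter_upwards [hKi.isClosed.isOpen_compl.mem_nhds hz] with w hw
    exact hzero w hw

theorem integral_divergence_eq_zero_of_subset_source [T2Space M] {c : M} {K : Set M}
    (hK : IsCompact K) (hKc : K ⊆ (extChartAt (𝓡 n) c).source)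
    {Y : Π x : M, TangentSpace (𝓡 n) x} (hY : ∀ x, SmoothFieldAt Y x) (h0 : ∀ x ∉ K, Y x = 0) :
    ∫ x, divergence Y x ∂(riemannianVolume n M) = 0 := by
  -- Off the chart domain `Y` vanishes on a neighbourhood, so the integral may be restricted to the
  -- domain.
  have hdiv0 : ∀ x ∉ (extChartAt (𝓡 n) c).source, divergence Y x = 0 := by
    intro x hx
    have hxK : x ∉ K := fun h => hx (hKc h)
    have h : divergence Y x = divergence (0 : Π x : M, TangentSpace (𝓡 n) x) x := by
      refine divergence_congr (hY x).diff (mdifferentiableAt_zeroSection ..) ?_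
      filter_upwards [hK.isClosed.isOpen_compl.mem_nhds hxK] with y hy
      exact h0 y hy
    rw [h, divergence]
    simp
  have hcont : Continuous (divergence Y) := continuous_of_smooth fun x => smooth_divergence (hY x)
  rw [← setIntegral_eq_integral_of_forall_compl_eq_zero hdiv0, riemannianVolume_restrict_source,
    integral_chartVolume c hcont.aestronglyMeasurable]
  let h : Fin n → M → ℝ := fun k y => density n c y * frameCoeff c k y (Y y)
  have hh : ∀ k, ∀ x ∈ (extChartAt (𝓡 n) c).source, SmoothFunAt n (h k) x := fun k x hx =>
    SmoothFunAt.mul (smooth_density hx) ((hY x).frameCoeff hx k)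
  have hh0 : ∀ k, ∀ x ∉ K, h k x = 0 := fun k x hx => by simp [h, h0 x hx]
  have hH := fun k => contDiff_indicator_comp_symm hK hKc (hh k) (hh0 k)
  set H : Fin n → EuclideanSpace ℝ (Fin n) → ℝ := fun k =>
    (extChartAt (𝓡 n) c).target.indicator (h k ∘ (extChartAt (𝓡 n) c).symm) with hHdef
  have hH1 : ∀ k, ContDiff ℝ 1 (H k) := fun k => (hH k).1.of_le (by simp)
  -- In coordinates the integrand becomes the Euclidean divergence of the compactly supported
  -- functions `√det g · Yᵏ`, extended by zero.
  have key : ∀ z ∈ (extChartAt (𝓡 n) c).target, density n c ((extChartAt (𝓡 n) c).symm z) *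
      divergence Y ((extChartAt (𝓡 n) c).symm z) =
      ∑ k, fderiv ℝ (H k) z (EuclideanSpace.single k 1) := by
    intro z hz
    have hx := (extChartAt (𝓡 n) c).map_target hz
    rw [density_mul_divergence hx (hY _)]
    refine Finset.sum_congr rfl fun k _ => ?_
    rw [mvfderiv_frame hx k (hh k _ hx).diff, (extChartAt (𝓡 n) c).right_inv hz]
    congr 1
    refine (Filter.EventuallyEq.fderiv_eq ?_).symm
    filter_upwards [(isOpen_extChartAt_target (I := 𝓡 n) c).mem_nhds hz] with w hw
    exact Set.indicator_of_mem hw _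
  rw [setIntegral_congr_fun (measurableSet_target n c) key,
    setIntegral_eq_integral_of_forall_compl_eq_zero]
  · rw [integral_finsetSum]
    · exact Finset.sum_eq_zero fun k _ =>
        integral_fderiv_apply_eq_zero volume (hH1 k) (hH k).2 _
    · intro k _
      exact (((hH1 k).continuous_fderiv one_ne_zero).clm_apply
        continuous_const).integrable_of_hasCompactSupport ((hH k).2.fderiv_apply ℝ _)
  · intro z hz
    refine Finset.sum_eq_zero fun k _ => ?_
    have hzK : z ∉ extChartAt (𝓡 n) c '' K := by
      rintro ⟨x, hx, rfl⟩
      exact hz ((extChartAt (𝓡 n) c).map_source (hKc hx))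
    have hKi : IsCompact (extChartAt (𝓡 n) c '' K) :=
      hK.image_of_continuousOn ((continuousOn_extChartAt c).mono hKc)
    have : H k =ᶠ[nhds z] fun _ => 0 := by
      filter_upwards [hKi.isClosed.isOpen_compl.mem_nhds hzK] with w hw
      by_cases hwt : w ∈ (extChartAt (𝓡 n) c).target
      · rw [hHdef]
        simp only [Set.indicator_of_mem hwt]
        exact hh0 k _ fun hm => hw ⟨_, hm, (extChartAt (𝓡 n) c).right_inv hwt⟩
      · exact Set.indicator_of_notMem hwt _
    rw [this.fderiv_eq]
    simp

theorem integrable_of_smooth [CompactSpace M] {f : M → ℝ} (hf : ∀ x, SmoothFunAt n f x) :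
    Integrable f (riemannianVolume n M) := by
  have := isLocallyFiniteMeasure_riemannianVolume (n := n) (M := M)
  exact (continuous_of_smooth hf).integrable_of_hasCompactSupport
    (HasCompactSupport.of_compactSpace f)

/-- The divergence theorem on a compact Riemannian manifold without boundary. -/
theorem integral_divergence_eq_zero [T2Space M] [CompactSpace M]
    {Y : Π x : M, TangentSpace (𝓡 n) x} (hY : ∀ x, SmoothFieldAt Y x) :
    ∫ x, divergence Y x ∂(riemannianVolume n M) = 0 := by
  obtain ⟨ρ, hρ⟩ := SmoothPartitionOfUnity.exists_isSubordinate_chartAt_source (𝓡 n) M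
  -- By compactness only finitely many members of the partition are nonzero, so `Y` is a finite sum
  -- of fields supported in single charts.
  have hfin : {c | (Function.support (ρ c)).Nonempty}.Finite :=
    ρ.locallyFinite.finite_nonempty_of_compact
  have hρs : ∀ c x, SmoothFunAt n (ρ c) x := fun c x => (ρ c).contMDiff x
  have hρY : ∀ c x, SmoothFieldAt ((ρ c : M → ℝ) • Y) x := fun c x =>
    SmoothFieldAt.smul (hρs c x) (hY x)
  have hsum : Y = ∑ c ∈ hfin.toFinset, (ρ c : M → ℝ) • Y := by
    funext x
    have h1 := ρ.sum_eq_one (Set.mem_univ x)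
    rw [finsum_eq_sum_of_support_subset (s := hfin.toFinset)] at h1
    · rw [Finset.sum_apply]
      simp only [Pi.smul_apply']
      rw [← Finset.sum_smul, h1, one_smul]
    · intro c hc
      rw [Set.Finite.coe_toFinset]
      exact ⟨x, hc⟩
  have hdiv : ∀ x, divergence Y x =
      ∑ c ∈ hfin.toFinset, divergence ((ρ c : M → ℝ) • Y) x := fun x => by
    conv_lhs => rw [hsum]
    exact divergence_sum fun c _ => (hρY c x).diff
  simp only [hdiv]
  rw [integral_finsetSum]
  · refine Finset.sum_eq_zero fun c _ => ?_
    refine integral_divergence_eq_zero_of_subset_source (c := c)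
      (isClosed_tsupport (ρ c)).isCompact ?_ (hρY c) fun x hx => ?_
    · rw [extChartAt_source]
      exact hρ c
    · rw [Pi.smul_apply', image_eq_zero_of_notMem_tsupport hx, zero_smul]
  · exact fun c _ => integrable_of_smooth fun x => smooth_divergence (hρY c x)

end DivergenceTheorem

/-! ### The pointwise Hessian inequality. -/

section HessianInequality

variable {n : ℕ} {M : Type*} [TopologicalSpace M] [ChartedSpace (EuclideanSpace ℝ (Fin n)) M]
  [IsManifold (𝓡 n) ∞ M]
  [RiemannianBundle (fun x : M => TangentSpace (𝓡 n) x)]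
  [IsContMDiffRiemannianBundle (𝓡 n) ∞ (EuclideanSpace ℝ (Fin n))
      (fun x : M => TangentSpace (𝓡 n) x)]

theorem mvfderiv_norm_sq {Y : Π x : M, TangentSpace (𝓡 n) x} {x : M} (hY : DiffFieldAt Y x)
    (v : TangentSpace (𝓡 n) x) :
    mvfderiv (𝓡 n) (fun y => (inner ℝ (Y y) (Y y) : ℝ)) x v =
      2 * inner ℝ (leviCivita (𝓡 n) M Y x v) (Y x) := by
  have h := leviCivita_metric (X := FiberBundle.extend (EuclideanSpace ℝ (Fin n)) v)
    (FiberBundle.mdifferentiableAt_extend ..) hY hY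
  rw [FiberBundle.extend_apply_self] at h
  rw [h, real_inner_comm (leviCivita (𝓡 n) M Y x v), two_mul]

theorem mvfderiv_eq_mul_mvfderiv_log {u : M → ℝ} {x : M} (hu : DiffFunAt n u x) (hpos : 0 < u x)
    (v : TangentSpace (𝓡 n) x) :
    mvfderiv (𝓡 n) u x v = u x * mvfderiv (𝓡 n) (fun y => Real.log (u y)) x v := by
  rw [mvfderiv_comp_real (Real.hasDerivAt_log hpos.ne') hu, mul_inv_cancel_left₀ hpos.ne']

theorem mvfderiv_sqrt {u : M → ℝ} {x : M} (hu : DiffFunAt n u x) (hpos : 0 < u x)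
    (v : TangentSpace (𝓡 n) x) :
    mvfderiv (𝓡 n) (fun y => √(u y)) x v =
      √(u x) / 2 * mvfderiv (𝓡 n) (fun y => Real.log (u y)) x v := by
  rw [mvfderiv_comp_real (Real.hasDerivAt_sqrt hpos.ne') hu, mvfderiv_eq_mul_mvfderiv_log hu hpos]
  have h := Real.mul_self_sqrt hpos.le
  have h2 := Real.sqrt_pos.2 hpos
  field_simp
  rw [sq, h]

/-- The Hessian of `√u` in terms of the Hessian and the gradient of `log u`. -/
theorem hessian_sqrt {u : M → ℝ} (hu : ∀ x, SmoothFunAt n u x) (hpos : ∀ x, 0 < u x) (x : M) :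
    hessian (𝓡 n) (fun y => √(u y)) x =
      (√(u x) / 2) • hessian (𝓡 n) (fun y => Real.log (u y)) x +
      (√(u x) / 4) • (innerSL ℝ (grad (𝓡 n) (fun y => Real.log (u y)) x)).smulRight
        (grad (𝓡 n) (fun y => Real.log (u y)) x) := by
  have hlog : SmoothFunAt n (fun y => Real.log (u y)) x :=
    SmoothFunAt.comp (Real.contDiffAt_log.2 (hpos x).ne') (hu x)
  have hsqrt : SmoothFunAt n (fun y => √(u y)) x :=
    SmoothFunAt.comp (Real.contDiffAt_sqrt (hpos x).ne') (hu x)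
  have hhalf : DiffFunAt n (fun y => √(u y) * (1 / 2)) x :=
    (SmoothFunAt.mul hsqrt (SmoothFunAt.const _ _)).diff
  have hgrad : grad (𝓡 n) (fun y => √(u y)) =
      (fun y => √(u y) * (1 / 2)) • grad (𝓡 n) (fun y => Real.log (u y)) := by
    funext y
    refine ext_inner_right ℝ fun w => ?_
    rw [Pi.smul_apply', inner_smul_left, inner_grad, inner_grad, mvfderiv_sqrt (hu y).diff (hpos y)]
    simp [div_eq_mul_inv]
  -- Leibniz rule for `∇√u = (√u/2) ∇log u`: differentiating the coefficient produces the rank one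
  -- term.
  rw [hessian, hgrad, leviCivita_smul hhalf (smooth_grad hlog).diff, hessian]
  congr 1
  · congr 1
    ring
  · ext1 w
    have h1 : mvfderiv (𝓡 n) (fun y => √(u y) * (1 / 2)) x w =
        1 / 2 * mvfderiv (𝓡 n) (fun y => √(u y)) x w :=
      mvfderiv_comp_real (φ := fun t => t * (1 / 2)) (f := fun y => √(u y))
        (by simpa using (hasDerivAt_id' (√(u x))).mul_const (1 / 2 : ℝ)) hsqrt.diff w
    simp only [ContinuousLinearMap.smulRight_apply, smul_apply, innerSL_apply_apply, h1,
      mvfderiv_sqrt (hu x).diff (hpos x), inner_grad, smul_smul]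
    congr 1
    ring

variable (n) in
/-- The vector field `u |∇ log u|² ∇ log u`. -/
def logGradField (u : M → ℝ) : Π x : M, TangentSpace (𝓡 n) x :=
  (fun y => u y * inner ℝ (grad (𝓡 n) (fun y => Real.log (u y)) y)
    (grad (𝓡 n) (fun y => Real.log (u y)) y)) • grad (𝓡 n) (fun y => Real.log (u y))

theorem smooth_logGradField {u : M → ℝ} (hu : ∀ x, SmoothFunAt n u x) (hpos : ∀ x, 0 < u x)
    (x : M) : SmoothFieldAt (logGradField n u) x := by
  have hlog : SmoothFunAt n (fun y => Real.log (u y)) x :=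
    SmoothFunAt.comp (Real.contDiffAt_log.2 (hpos x).ne') (hu x)
  exact SmoothFieldAt.smul (SmoothFunAt.mul (hu x) ((smooth_grad hlog).inner (smooth_grad hlog)))
    (smooth_grad hlog)

/-- Differentiating `u` gives `u ∇log u`, whence the quartic term; differentiating `|∇log u|²` gives
the quadratic form of the Hessian by metric compatibility. -/
theorem divergence_logGradField {u : M → ℝ} (hu : ∀ x, SmoothFunAt n u x) (hpos : ∀ x, 0 < u x)
    (x : M) : divergence (logGradField n u) x =
      u x * (‖grad (𝓡 n) (fun y => Real.log (u y)) x‖ ^ 2 *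
        LinearMap.trace ℝ (TangentSpace (𝓡 n) x)
          (hessian (𝓡 n) (fun y => Real.log (u y)) x : TangentSpace (𝓡 n) x →ₗ[ℝ] _)
      + 2 * inner ℝ (hessian (𝓡 n) (fun y => Real.log (u y)) x
          (grad (𝓡 n) (fun y => Real.log (u y)) x)) (grad (𝓡 n) (fun y => Real.log (u y)) x)
      + ‖grad (𝓡 n) (fun y => Real.log (u y)) x‖ ^ 4) := by
  have hlog : SmoothFunAt n (fun y => Real.log (u y)) x :=
    SmoothFunAt.comp (Real.contDiffAt_log.2 (hpos x).ne') (hu x)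
  have hg := smooth_grad hlog
  have hn := hg.inner hg
  rw [logGradField, divergence_smul (SmoothFunAt.mul (hu x) hn).diff hg.diff]
  have h2 := DFunLike.congr_fun (mvfderiv_mul (hu x).diff hn.diff)
    (grad (𝓡 n) (fun y => Real.log (u y)) x)
  refine (congrArg₂ (· + ·) rfl h2).trans ?_
  simp only [add_apply, smul_apply, smul_eq_mul]
  rw [mvfderiv_norm_sq hg.diff]
  simp only [mvfderiv_eq_mul_mvfderiv_log (hu x).diff (hpos x), ← inner_grad,
    real_inner_self_eq_norm_sq]
  rw [divergence]
  unfold hessian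
  ring

theorem finrank_tangentSpace (x : M) : Module.finrank ℝ (TangentSpace (𝓡 n) x) = n :=
  finrank_euclideanSpace_fin (𝕜 := ℝ) (n := n)

theorem endNormSq_nonneg {x : M} (A : TangentSpace (𝓡 n) x →L[ℝ] TangentSpace (𝓡 n) x) :
    0 ≤ endNormSq A :=
  trace_adjoint_comp_nonneg A

/-- Young's inequality for the trace `T` and the values `P = ⟨A v, v⟩` of an endomorphism `A` with
`S = |A|²`, against the fourth power of `r = ‖v‖`. -/
theorem young_trace_quadratic {S T P r m : ℝ} (hS : 0 ≤ S) (hT : T ^ 2 ≤ m * S)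
    (hP : P ^ 2 ≤ S * r ^ 4) :
    r ^ 4 / 8 ≤ (m + 4) / 4 * S + 1 / 4 * (r ^ 2 * T + 2 * P + r ^ 4) := by
  -- Each of the two mixed terms is allowed a quarter of `r ^ 4`, leaving half of it; dividing by
  -- `4` yields the `1/8` needed later. Here `(2P)² ≤ 4 S r⁴ ≤ (r⁴/4 + 4S)²` by AM–GM.
  have hP2 : -(2 * P) ≤ r ^ 4 / 4 + 4 * S := by
    refine le_of_abs_le (abs_le_of_sq_le_sq ?_ (by positivity))
    nlinarith [sq_nonneg (r ^ 4 / 4 - 4 * S)]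
  have hT2 : -(r ^ 2 * T) ≤ r ^ 4 / 4 + m * S := by
    nlinarith [sq_nonneg (r ^ 2 / 2 + T)]
  linarith

theorem inner_apply_sq_le {x : M} (A : TangentSpace (𝓡 n) x →L[ℝ] TangentSpace (𝓡 n) x)
    (v : TangentSpace (𝓡 n) x) : (inner ℝ (A v) v : ℝ) ^ 2 ≤ endNormSq A * ‖v‖ ^ 4 := by
  have h3 : ‖A v‖ ^ 2 ≤ endNormSq A * ‖v‖ ^ 2 := norm_apply_sq_le A v
  have h4 := abs_real_inner_le_norm (A v) v
  calc (inner ℝ (A v) v : ℝ) ^ 2 ≤ (‖A v‖ * ‖v‖) ^ 2 :=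
        sq_le_sq' (neg_le_of_abs_le h4) (le_of_abs_le h4)
    _ = ‖A v‖ ^ 2 * ‖v‖ ^ 2 := mul_pow _ _ _
    _ ≤ endNormSq A * ‖v‖ ^ 2 * ‖v‖ ^ 2 := mul_le_mul_of_nonneg_right h3 (sq_nonneg _)
    _ = endNormSq A * ‖v‖ ^ 4 := by ring

/-- The Hilbert–Schmidt bound leaves `w/2 · |A|² + w/8 · ‖v‖⁴`. The quartic part is precisely the
left side of `young_trace_quadratic` times `w`, and `1/2 + (n+4)/4 = (n+6)/4`. -/
theorem endNormSq_smul_add_le {x : M} (A : TangentSpace (𝓡 n) x →L[ℝ] TangentSpace (𝓡 n) x)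
    (v : TangentSpace (𝓡 n) x) {w : ℝ} (hw : 0 ≤ w) :
    endNormSq ((√w / 2) • A + (√w / 4) • (innerSL ℝ v).smulRight v) ≤
      (n + 6) / 4 * (w * endNormSq A) + 1 / 4 * (w * (‖v‖ ^ 2 *
        LinearMap.trace ℝ (TangentSpace (𝓡 n) x) (A : TangentSpace (𝓡 n) x →ₗ[ℝ] _)
        + 2 * inner ℝ (A v) v + ‖v‖ ^ 4)) := by
  have h1 : endNormSq ((√w / 2) • A + (√w / 4) • (innerSL ℝ v).smulRight v) ≤
      2 * (√w / 2) ^ 2 * endNormSq A + 2 * (√w / 4) ^ 2 * ‖v‖ ^ 4 :=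
    trace_adjoint_comp_smul_add_le A (√w / 2) (√w / 4) v
  have h2 := trace_sq_le A
  rw [finrank_tangentSpace] at h2
  have h3 := mul_le_mul_of_nonneg_left
    (young_trace_quadratic (endNormSq_nonneg A) h2 (inner_apply_sq_le A v)) hw
  refine h1.trans ?_
  rw [div_pow, div_pow, Real.sq_sqrt hw]
  linarith

theorem endNormSq_hessian_sqrt_le {u : M → ℝ} (hu : ∀ x, SmoothFunAt n u x) (hpos : ∀ x, 0 < u x)
    (x : M) : endNormSq (hessian (𝓡 n) (fun y => √(u y)) x) ≤
      (n + 6) / 4 * (u x * endNormSq (hessian (𝓡 n) (fun y => Real.log (u y)) x)) +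
      1 / 4 * divergence (logGradField n u) x := by
  rw [hessian_sqrt hu hpos, divergence_logGradField hu hpos]
  exact endNormSq_smul_add_le _ _ (hpos x).le

end HessianInequality

end RiemHess

end

/-! ### Integration of the pointwise inequality. -/

theorem theorem1p1 (n : ℕ) (M : Type*) [TopologicalSpace M] [T2Space M] [CompactSpace M]
    [ChartedSpace (EuclideanSpace ℝ (Fin n)) M] [IsManifold (𝓡 n) ∞ M]
    [MeasurableSpace M] [BorelSpace M]
    [RiemannianBundle (fun x : M => TangentSpace (𝓡 n) x)]
    [IsContMDiffRiemannianBundle (𝓡 n) ∞ (EuclideanSpace ℝ (Fin n))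
      (fun x : M => TangentSpace (𝓡 n) x)] :
    ∃ C : ℝ, 0 < C ∧ ∀ u : M → ℝ, ContMDiff (𝓡 n) 𝓘(ℝ, ℝ) ∞ u → (∀ x, 0 < u x) →
      ∫ x, RiemHess.endNormSq (RiemHess.hessian (𝓡 n) (fun y => √(u y)) x)
          ∂(RiemHess.riemannianVolume n M)
        ≤ C * ∫ x, u x * RiemHess.endNormSq (RiemHess.hessian (𝓡 n) (fun y => Real.log (u y)) x)
          ∂(RiemHess.riemannianVolume n M) := by
  -- The constant depends only on the dimension.
  refine ⟨(n + 6) / 4, by positivity, fun u hu hpos => ?_⟩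
  have hu' : ∀ x, RiemHess.SmoothFunAt n u x := fun x => hu x
  have hlog : ∀ x, RiemHess.SmoothFunAt n (fun y => Real.log (u y)) x := fun x =>
    RiemHess.SmoothFunAt.comp (Real.contDiffAt_log.2 (hpos x).ne') (hu' x)
  have hY := RiemHess.smooth_logGradField hu' hpos
  have hdiv := RiemHess.integrable_of_smooth fun x => RiemHess.smooth_divergence (hY x)
  have hlogint : Integrable (fun x => u x *
      RiemHess.endNormSq (RiemHess.hessian (𝓡 n) (fun y => Real.log (u y)) x))
      (RiemHess.riemannianVolume n M) :=
    RiemHess.integrable_of_smooth fun x => RiemHess.SmoothFunAt.mul (hu' x)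
      (RiemHess.smooth_endNormSq_leviCivita (RiemHess.smooth_grad (hlog x)))
  -- As the left integrand is nonnegative, only the majorant has to be integrable.
  have hle := integral_mono_of_nonneg (μ := RiemHess.riemannianVolume n M)
    (Filter.Eventually.of_forall fun x => RiemHess.endNormSq_nonneg
      (RiemHess.hessian (𝓡 n) (fun y => √(u y)) x))
    ((hlogint.const_mul ((n + 6 : ℝ) / 4)).add (hdiv.const_mul (1 / 4)))
    (Filter.Eventually.of_forall fun x => RiemHess.endNormSq_hessian_sqrt_le hu' hpos x)
  rw [integral_add' (hlogint.const_mul _) (hdiv.const_mul _), integral_const_mul,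
    integral_const_mul, RiemHess.integral_divergence_eq_zero hY, mul_zero, add_zero] at hle
  exact hle
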